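/- Let $M$ be a complex manifold of dimension $m$ with a Kähler metric $g_M$, and let $\pi:(L,h)\to M$ be a holomorphic line bundle with a smooth Hermitian metric such that the Kähler form is $\omega_M=-\sqrt{-1}\,\partial\bar\partial\log h$ (where $h=|s|_h^2$ for a local holomorphic frame $s$, and a metric $\sum g_{j\bar k}\,dz_j\,d\bar z_k$ has the form $\sqrt{-1}\sum g_{j\bar k}\,dz_j\wedge d\bar z_k$). Let $(L^*,h^{-1})$ be the dual bundle, with projection again denoted $\pi:L^*\to M$, and let $D(L^*)=\{\eta\in L^*:|\eta|_{h^{-1}}<1\}$. Then $$\omega_D=\pi^*\omega_M-\sqrt{-1}\,\partial\bar\partial\log\bigl(1-|\eta|^2_{h^{-1}}\bigr)$$ is the Kähler form of a Kähler metric $g_D$ on $D(L^*)$, and the following holds. For every $\eta_0\in D(L^*)$, with $z_0=\pi(\eta_0)$, there are holomorphic coordinates $z=(z_1,\dots,z_m)$ of $M$ around $z_0$ and a holomorphic frame $s$ of $L$ on their domain such that $(z,v)$, with $v(\eta)=\eta(s)$, are holomorphic coordinates of $L^*$ around $\eta_0$ and * at $z_0$ one has $g_{j\bar k}=\delta_{jk}$,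 all first derivatives of the coefficients $g_{j\bar k}$ of $g_M$ vanish, and $|s(z_0)|_h=1$, so that $|v|^2:=|v(\eta_0)|^2=|\eta_0|^2_{h^{-1}}$; * $\displaystyle g_D(\eta_0)=\frac{1}{1-|v|^2}\Bigl(\frac{dv\,\overline{dv}}{1-|v|^2}+\sum_j dz_j\,\overline{dz_j}\Bigr)$; * for every nonzero $U\in T^{1,0}_{\eta_0}D(L^*)$, with $X=d\pi(U)$, the holomorphic sectional curvature $\Theta_D$ of $g_D$ is $$\Theta_D(\eta_0,U)=\frac{-2\Bigl(g_D(U,\bar U)^2-\dfrac{g_M(X,\bar X)^2}{1-|v|^2}\bigl(1+\tfrac12\Theta_M(z_0,X)\bigr)\Bigr)}{g_D(U,\bar U)^2}.$$ Here the holomorphic sectional curvature of a Kähler metric $g$ is $\Theta(p,U)=R(U,\bar U,U,\bar U)/g(U,\bar U)^2$ with $R_{i\bar jk\bar l}=-\partial_k\partial_{\bar l}g_{i\bar j}+g^{\bar q p}\,\partial_kg_{i\bar q}\,\partial_{\bar l}g_{p\bar j}$; for $X=0$ the term containing $g_M(X,\bar X)^2\,\Theta_M(z_0,X)$ is read as $0$.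 -/

import Mathlib

open Bundle
open scoped Manifold ContDiff

/-! ### Wirtinger calculus on a complex normed space -/

section Wirtinger

variable {E : Type*} [NormedAddCommGroup E] [NormedSpace ℂ E]

/-- The `(1,0)`-derivative `∂_u F = ∑ u_j ∂F/∂z_j` of a real-differentiable `F` at `x`. -/
noncomputable def wirtinger (F : E → ℂ) (x u : E) : ℂ :=
  (fderiv ℝ F x u - Complex.I * fderiv ℝ F x (Complex.I • u)) / 2

/-- The `(0,1)`-derivative `∂_{ū} F = ∑ ū_j ∂F/∂z̄_j` of a real-differentiable `F` at `x`. -/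
noncomputable def wirtingerBar (F : E → ℂ) (x u : E) : ℂ :=
  (fderiv ℝ F x u + Complex.I * fderiv ℝ F x (Complex.I • u)) / 2

/-- `∑ (∂²F/∂z_j∂z̄_k) u_j v̄_k` at `x`. -/
noncomputable def ddbar (F : E → ℂ) (x u v : E) : ℂ :=
  wirtinger (fun y => wirtingerBar F y v) x u

end Wirtinger

/-- `g` is a Hermitian inner product, linear in the first and conjugate linear in the second
variable. -/
structure IsHermitianInner {V : Type*} [AddCommGroup V] [Module ℂ V] (g : V → V → ℂ) : Prop where
  add_left : ∀ u v w, g (u + v) w = g u w + g v w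
  smul_left : ∀ (c : ℂ) (u w), g (c • u) w = c * g u w
  conj_symm : ∀ u w, g w u = (starRingEnd ℂ) (g u w)
  pos : ∀ u, u ≠ 0 → 0 < (g u u).re

/-! ### Curvature of a Hermitian metric in coordinates -/

section Coordinates

variable {E : Type*} [NormedAddCommGroup E] [NormedSpace ℂ E] [FiniteDimensional ℂ E]

/-- The matrix `T = (g_{jk̄})` of a sesquilinear form in a basis of the coordinate space. -/
noncomputable def metricMatrix (g : E → E → ℂ) :
    Matrix (Fin (Module.finrank ℂ E)) (Fin (Module.finrank ℂ E)) ℂ :=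
  fun j k => g (Module.finBasis ℂ E j) (Module.finBasis ℂ E k)

/-- The curvature `R(U, Ū, U, Ū)` at `x`, where `G` gives the metric coefficients in coordinates:
with `U = ∑ u_j ∂/∂z_j` it is `u (-∂∂̄ T + ∂T · T⁻¹ · (∂T)^*) u^*`, that is
`-∑ (∂²g_{jk̄}/∂z_p∂z̄_q) u_j ū_k u_p ū_q + ∑ g^{b̄a} (∂g_{jā}/∂z_p)(∂g_{bk̄}/∂z̄_q) u_j ū_k u_p ū_q`. -/
noncomputable def curvatureQuartic (G : E → E → E → ℂ) (x u : E) : ℂ :=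
  let r : Fin (Module.finrank ℂ E) → ℂ :=
    fun k => wirtinger (fun y => G y u (Module.finBasis ℂ E k)) x u
  dotProduct (Matrix.vecMul r (metricMatrix (G x))⁻¹) (star r) - ddbar (fun y => G y u u) x u u

/-- The holomorphic sectional curvature `R(U, Ū, U, Ū) / g(U, Ū)²` in coordinates. -/
noncomputable def holSectCurvCoord (G : E → E → E → ℂ) (x u : E) : ℝ :=
  (curvatureQuartic G x u).re / (G x u u).re ^ 2

end Coordinates

/-! ### Hermitian and Kähler metrics on a complex manifold -/

section Manifold

variable {E : Type*} [NormedAddCommGroup E] [NormedSpace ℂ E]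
  {H : Type*} [TopologicalSpace H] (I : ModelWithCorners ℂ E H)
  {N : Type*} [TopologicalSpace N] [ChartedSpace H N]

/-- A field of `ℂ`-valued forms `g(U, V̄)` on the (holomorphic) tangent spaces. -/
abbrev FormField (I : ModelWithCorners ℂ E H) (N : Type*) [TopologicalSpace N]
    [ChartedSpace H N] : Type _ :=
  ∀ p : N, TangentSpace I p → TangentSpace I p → ℂ

/-- The coefficients of `g` in the coordinates whose inverse (parametrization) is `ψ`. -/
noncomputable def coeffs {E' : Type*} [NormedAddCommGroup E'] [NormedSpace ℂ E']
    (g : FormField I N) (ψ : E' → N) (y a b : E') : ℂ :=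
  g (ψ y) (mfderiv 𝓘(ℂ, E') I ψ y a) (mfderiv 𝓘(ℂ, E') I ψ y b)

/-- `Φ` is a holomorphic coordinate system (on its source) with values in `E'`. -/
structure IsHolomorphicChart {E' : Type*} [NormedAddCommGroup E'] [NormedSpace ℂ E']
    (Φ : OpenPartialHomeomorph N E') : Prop where
  holo : ContMDiffOn I 𝓘(ℂ, E') ω Φ Φ.source
  holo_symm : ContMDiffOn 𝓘(ℂ, E') I ω Φ.symm Φ.target

/-- The real-valued function `f` is smooth (in the real sense) at `p`. -/
def RealSmoothAt (f : N → ℝ) (p : N) : Prop :=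
  ContDiffAt ℝ ∞ (f ∘ (extChartAt I p).symm) (extChartAt I p p)

/-- `g` is a Kähler metric on the open set `S`: it is Hermitian, positive definite and smooth, and
its fundamental form is closed (`∂g_{jk̄}/∂z_l = ∂g_{lk̄}/∂z_j`). -/
structure IsKahlerOn (g : FormField I N) (S : Set N) : Prop where
  hermitian : ∀ p ∈ S, IsHermitianInner (V := TangentSpace I p) (g p)
  smooth : ∀ p ∈ S, ∀ a b : E,
    ContDiffAt ℝ ∞ (fun y => coeffs I g (extChartAt I p).symm y a b) (extChartAt I p p)
  closed : ∀ p ∈ S, ∀ a b c : E,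
    wirtinger (fun y => coeffs I g (extChartAt I p).symm y a b) (extChartAt I p p) c =
      wirtinger (fun y => coeffs I g (extChartAt I p).symm y c b) (extChartAt I p p) a

/-- The coefficients `∑ (∂²f/∂z_j∂z̄_k) u_j v̄_k` of `∂∂̄ f` at `p`. -/
noncomputable def leviForm (f : N → ℝ) : FormField I N := fun p U V =>
  ddbar (fun y : E => ((f ((extChartAt I p).symm y) : ℝ) : ℂ)) (extChartAt I p p) U V

/-- The holomorphic sectional curvature `Θ(p, U)` of `g`. -/
noncomputable def holSectCurv [FiniteDimensional ℂ E] (g : FormField I N) (p : N)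
    (U : TangentSpace I p) : ℝ :=
  holSectCurvCoord (coeffs I g (extChartAt I p).symm) (extChartAt I p p) U

/-- In the holomorphic coordinates `e` around `p` the metric `g` satisfies `g_{jk̄} = δ_{jk}`
and has vanishing first derivatives at `p` (geodesic coordinates). -/
structure IsGeodesicAt {m : ℕ} (g : FormField I N)
    (e : OpenPartialHomeomorph N (EuclideanSpace ℂ (Fin m))) (p : N) : Prop where
  chart : IsHolomorphicChart I e
  mem : p ∈ e.source
  unit : ∀ a b : EuclideanSpace ℂ (Fin m),
    coeffs I g e.symm (e p) a b = ∑ j, a j * (starRingEnd ℂ) (b j)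
  deriv_zero : ∀ a b c : EuclideanSpace ℂ (Fin m),
    wirtinger (fun y => coeffs I g e.symm y a b) (e p) c = 0 ∧
      wirtingerBar (fun y => coeffs I g e.symm y a b) (e p) c = 0

end Manifold

/-! ### Hermitian holomorphic line bundles and the disc bundle of the dual -/

section LineBundle

variable {E : Type*} [NormedAddCommGroup E] [NormedSpace ℂ E]
  {H : Type*} [TopologicalSpace H] (I : ModelWithCorners ℂ E H)
  {M : Type*} [TopologicalSpace M] [ChartedSpace H M]
  (L : M → Type*) [∀ x, AddCommGroup (L x)] [∀ x, Module ℂ (L x)] [∀ x, TopologicalSpace (L x)]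
  [TopologicalSpace (TotalSpace ℂ L)] [FiberBundle ℂ L] [VectorBundle ℂ ℂ L]

/-- The local holomorphic frame of `L` around `p` given by the preferred trivialization there. -/
noncomputable def localFrame (p x : M) : L x := (trivializationAt ℂ L p).symm x 1

/-- A smooth Hermitian metric on the line bundle `L`. -/
structure HermitianLineMetric where
  /-- the inner product `h(s, t̄)` on each fibre -/
  form : ∀ x, L x → L x → ℂ
  hermitian : ∀ x, IsHermitianInner (form x)
  smooth : ∀ p, RealSmoothAt I (fun x => (form x (localFrame L p x) (localFrame L p x)).re) p

/-- The total space of the dual line bundle `L*`. -/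
abbrev DualTotal : Type _ :=
  TotalSpace (ℂ →L[ℂ] ℂ) (fun x => L x →L[ℂ] Bundle.Trivial M ℂ x)

/-- The model with corners of the complex manifold `L*`. -/
noncomputable abbrev dualModel : ModelWithCorners ℂ (E × (ℂ →L[ℂ] ℂ)) (ModelProd H (ℂ →L[ℂ] ℂ)) :=
  I.prod 𝓘(ℂ, ℂ →L[ℂ] ℂ)

variable {I L}

/-- `|s|²_h = h(s, s̄)`. -/
def HermitianLineMetric.normSq (h : HermitianLineMetric I L) {x : M} (s : L x) : ℝ :=
  (h.form x s s).re

/-- The coefficients of `-∂∂̄ log h`, computed as `-∂∂̄ log |s|²_h` in a local holomorphic frame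
`s` of `L`. -/
noncomputable def HermitianLineMetric.curvatureForm (h : HermitianLineMetric I L) :
    FormField I M := fun p U V =>
  -leviForm I (fun x => Real.log (h.normSq (localFrame L p x))) p U V

/-- `|η|²_{h⁻¹} = |η(s)|² / |s|²_h`, with `s ≠ 0` in the fibre of `L` under `η`. -/
noncomputable def HermitianLineMetric.dualNormSq (h : HermitianLineMetric I L)
    (η : DualTotal L) : ℝ :=
  ‖(η.2 (localFrame L η.1 η.1) : ℂ)‖ ^ 2 / h.normSq (localFrame L η.1 η.1)

/-- The disc bundle `D(L*) = {|η|_{h⁻¹} < 1}`, an open subset of `L*`. -/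
def HermitianLineMetric.discBundle (h : HermitianLineMetric I L) : Set (DualTotal L) :=
  {η | h.dualNormSq η < 1}

/-- The differential `dπ` of the projection `π : L* → M`. -/
noncomputable def dualProjDeriv (η : DualTotal L) (U : TangentSpace (dualModel I) η) :
    TangentSpace I η.1 :=
  mfderiv (dualModel I) I
    (TotalSpace.proj : DualTotal L → M) η U

/-- The metric `g_D` with fundamental form `π^* ω_M - √-1 ∂∂̄ log (1 - |η|²_{h⁻¹})`. -/
noncomputable def HermitianLineMetric.discMetric (h : HermitianLineMetric I L)
    (gM : FormField I M) : FormField (dualModel I) (DualTotal L) := fun η U V =>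
  gM η.1 (dualProjDeriv η U) (dualProjDeriv η V) -
    leviForm (dualModel I) (fun ξ : DualTotal L => Real.log (1 - h.dualNormSq ξ)) η U V

end LineBundle

/-!
Near a point of `L*` the form `ω_D` has the potential `φ - log (1 - |v|² e^φ)`, where
`φ = -log |s|²_h` for a local holomorphic frame `s` and `v(η) = η(s)`. With the connection form
`θ = dv + v ∂φ` and `ρ = 1 - |v|² e^φ`, its complex Hessian is `∂∂̄φ / ρ + e^φ θ θ̄ / ρ²`, hence
positive; a metric with local potentials is smooth and closed.

The curvature needs no inverse matrix: `R(U, Ū, U, Ū) = g(w, w̄) - ∂_U ∂_Ū g(U, Ū)`, where `w` is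
the vector with `g(w, ·) = ∂_U g(U, ·)`. For `g_D` this vector is the solution on the base,
corrected by a multiple of `U` and a multiple of the fibre direction. In any chart this gives
`R_D = (R_M + 2 g_M(X, X̄)²) / ρ - 2 g_D(U, Ū)²`.

A quadratic change of base coordinates kills the Christoffel symbols, and rescaling the frame by the
exponential of an affine function makes `φ` vanish to first order, so that `θ = dv` at the given
point.
-/

open scoped ComplexConjugate Topology

section WirtingerDerivatives

variable {E : Type*} [NormedAddCommGroup E] [NormedSpace ℂ E]
  {E' : Type*} [NormedAddCommGroup E'] [NormedSpace ℂ E']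

theorem wirtinger_add_right (F : E → ℂ) (x u v : E) :
    wirtinger F x (u + v) = wirtinger F x u + wirtinger F x v := by
  simp only [wirtinger, smul_add, map_add]
  ring

theorem map_complex_smul_eq_re_im (L : E →L[ℝ] ℂ) (c : ℂ) (u : E) :
    L (c • u) = c.re * L u + c.im * L (Complex.I • u) := by
  have hcu : c • u = c.re • u + c.im • (Complex.I • u) := by
    conv_lhs => rw [← Complex.re_add_im c, add_smul, mul_smul]
    rfl
  rw [hcu, map_add, map_smul, map_smul, Complex.real_smul, Complex.real_smul]

theorem wirtinger_smul_right (F : E → ℂ) (x : E) (c : ℂ) (u : E) :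
    wirtinger F x (c • u) = c * wirtinger F x u := by
  simp only [wirtinger, smul_smul]
  rw [map_complex_smul_eq_re_im _ (Complex.I * c), map_complex_smul_eq_re_im _ c]
  simp only [Complex.mul_re, Complex.mul_im, Complex.I_re, Complex.I_im, zero_mul, one_mul,
    zero_sub, zero_add, Complex.ofReal_neg]
  linear_combination (c.im : ℂ) * fderiv ℝ F x (Complex.I • u) / 2 * Complex.I_mul_I
    + (fderiv ℝ F x u - Complex.I * fderiv ℝ F x (Complex.I • u)) / 2 * Complex.re_add_im c

theorem wirtinger_zero_right (F : E → ℂ) (x : E) : wirtinger F x 0 = 0 := by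
  simp [wirtinger]

theorem wirtinger_conj (F : E → ℂ) (x u : E) :
    wirtinger (fun y => conj (F y)) x u = conj (wirtingerBar F x u) := by
  have hfderiv : fderiv ℝ (fun y => conj (F y)) x
      = (Complex.conjCLE : ℂ →L[ℝ] ℂ).comp (fderiv ℝ F x) :=
    Complex.conjCLE.comp_fderiv (f := F)
  simp only [wirtinger, wirtingerBar, hfderiv]
  simp [sub_eq_add_neg, Complex.conj_ofNat]

theorem wirtingerBar_conj (F : E → ℂ) (x u : E) :
    wirtingerBar (fun y => conj (F y)) x u = conj (wirtinger F x u) := by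
  simpa using (congrArg conj (wirtinger_conj (fun y => conj (F y)) x u)).symm

theorem conj_wirtingerBar_ofReal (f : E → ℝ) (x u : E) :
    conj (wirtingerBar (fun y => (f y : ℂ)) x u) = wirtinger (fun y => (f y : ℂ)) x u := by
  simpa using (wirtinger_conj (fun y => (f y : ℂ)) x u).symm

theorem conj_wirtinger_ofReal (f : E → ℝ) (x u : E) :
    conj (wirtinger (fun y => (f y : ℂ)) x u) = wirtingerBar (fun y => (f y : ℂ)) x u := by
  rw [← conj_wirtingerBar_ofReal, Complex.conj_conj]

theorem wirtinger_congr {F G : E → ℂ} {x : E} (h : F =ᶠ[𝓝 x] G) (u : E) :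
    wirtinger F x u = wirtinger G x u := by
  simp only [wirtinger, h.fderiv_eq]

theorem wirtingerBar_congr {F G : E → ℂ} {x : E} (h : F =ᶠ[𝓝 x] G) (u : E) :
    wirtingerBar F x u = wirtingerBar G x u := by
  simp only [wirtingerBar, h.fderiv_eq]

theorem ddbar_congr {F G : E → ℂ} {x : E} (h : F =ᶠ[𝓝 x] G) (u v : E) :
    ddbar F x u v = ddbar G x u v :=
  wirtinger_congr (h.eventuallyEq_nhds.mono fun _ hy => wirtingerBar_congr hy v) u

/-- `F` is real-differentiable at `x`, and its Wirtinger derivatives there are `∂_u F = d` and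
`∂_{ū} F = d'`. Both are carried along so that the product rule and complex conjugation can be
applied to the pair. -/
structure HasWirtingerAt (F : E → ℂ) (x u : E) (d d' : ℂ) : Prop where
  differentiableAt : DifferentiableAt ℝ F x
  wirtinger_eq : wirtinger F x u = d
  wirtingerBar_eq : wirtingerBar F x u = d'

namespace HasWirtingerAt

variable {F G : E → ℂ} {x u : E} {d d' e e' : ℂ}

theorem of_differentiableAt (h : DifferentiableAt ℝ F x) (u : E) :
    HasWirtingerAt F x u (wirtinger F x u) (wirtingerBar F x u) := ⟨h, rfl, rfl⟩

theorem congr_deriv (h : HasWirtingerAt F x u d d') (h1 : d = e) (h2 : d' = e') :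
    HasWirtingerAt F x u e e' := h1 ▸ h2 ▸ h

theorem congr_of_eventuallyEq (h : HasWirtingerAt F x u d d') (h1 : G =ᶠ[𝓝 x] F) :
    HasWirtingerAt G x u d d' :=
  ⟨h.differentiableAt.congr_of_eventuallyEq h1, (wirtinger_congr h1 u).trans h.wirtinger_eq,
    (wirtingerBar_congr h1 u).trans h.wirtingerBar_eq⟩

theorem const (c : ℂ) (x u : E) : HasWirtingerAt (fun _ => c) x u 0 0 :=
  ⟨by fun_prop, by simp [wirtinger], by simp [wirtingerBar]⟩

theorem add (hF : HasWirtingerAt F x u d d') (hG : HasWirtingerAt G x u e e') :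
    HasWirtingerAt (fun y => F y + G y) x u (d + e) (d' + e') := by
  obtain ⟨hF, rfl, rfl⟩ := hF
  obtain ⟨hG, rfl, rfl⟩ := hG
  refine ⟨hF.add hG, ?_, ?_⟩ <;>
  · simp only [wirtinger, wirtingerBar, fderiv_fun_add hF hG, add_apply]
    ring

theorem mul (hF : HasWirtingerAt F x u d d') (hG : HasWirtingerAt G x u e e') :
    HasWirtingerAt (fun y => F y * G y) x u (d * G x + F x * e) (d' * G x + F x * e') := by
  obtain ⟨hF, rfl, rfl⟩ := hF
  obtain ⟨hG, rfl, rfl⟩ := hG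
  refine ⟨hF.mul hG, ?_, ?_⟩ <;>
  · simp only [wirtinger, wirtingerBar, fderiv_fun_mul hF hG, add_apply, smul_apply, smul_eq_mul]
    ring

theorem star (hF : HasWirtingerAt F x u d d') :
    HasWirtingerAt (fun y => conj (F y)) x u (conj d') (conj d) := by
  obtain ⟨hF, rfl, rfl⟩ := hF
  exact ⟨(Complex.conjCLE.differentiableAt (x := F x)).comp x hF, wirtinger_conj _ _ _,
    wirtingerBar_conj _ _ _⟩

theorem comp_hasDerivAt {g : ℂ → ℂ} {g' : ℂ} (hF : HasWirtingerAt F x u d d')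
    (hg : HasDerivAt g g' (F x)) :
    HasWirtingerAt (fun y => g (F y)) x u (g' * d) (g' * d') := by
  obtain ⟨hF, rfl, rfl⟩ := hF
  have hgF : HasFDerivAt (fun y => g (F y)) _ x :=
    (hg.hasFDerivAt.restrictScalars ℝ).comp x hF.hasFDerivAt
  refine ⟨hgF.differentiableAt, ?_, ?_⟩ <;>
  · simp only [wirtinger, wirtingerBar, hgF.fderiv, ContinuousLinearMap.comp_apply,
      ContinuousLinearMap.coe_restrictScalars', ContinuousLinearMap.toSpanSingleton_apply,
      smul_eq_mul]
    ring

theorem neg (hF : HasWirtingerAt F x u d d') :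
    HasWirtingerAt (fun y => -F y) x u (-d) (-d') := by
  simpa using (const (-1) x u).mul hF

theorem sub (hF : HasWirtingerAt F x u d d') (hG : HasWirtingerAt G x u e e') :
    HasWirtingerAt (fun y => F y - G y) x u (d - e) (d' - e') := by
  simpa only [sub_eq_add_neg] using hF.add hG.neg

theorem inv (hF : HasWirtingerAt F x u d d') (h0 : F x ≠ 0) :
    HasWirtingerAt (fun y => (F y)⁻¹) x u (-d / F x ^ 2) (-d' / F x ^ 2) :=
  (hF.comp_hasDerivAt (hasDerivAt_inv h0)).congr_deriv (by ring) (by ring)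

theorem rexp {f : E → ℝ} (hF : HasWirtingerAt (fun y => (f y : ℂ)) x u d d') :
    HasWirtingerAt (fun y => (Real.exp (f y) : ℂ)) x u (Real.exp (f x) * d)
      (Real.exp (f x) * d') := by
  simp only [Complex.ofReal_exp]
  exact hF.comp_hasDerivAt (Complex.hasDerivAt_exp _)

theorem log {f : E → ℝ} (hF : HasWirtingerAt (fun y => (f y : ℂ)) x u d d') (h0 : 0 < f x) :
    HasWirtingerAt (fun y => (Real.log (f y) : ℂ)) x u (d / f x) (d' / f x) := by
  have hf : ContinuousAt f x :=
    Complex.continuous_re.continuousAt.comp (f := fun y => (f y : ℂ))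
      hF.differentiableAt.continuousAt
  have hlog : (fun y => (Real.log (f y) : ℂ)) =ᶠ[𝓝 x] fun y => Complex.log (f y) := by
    filter_upwards [hf.eventually (lt_mem_nhds h0)] with y hy
    exact Complex.ofReal_log hy.le
  have hslit : (f x : ℂ) ∈ Complex.slitPlane := Or.inl (by simpa using h0)
  exact ((hF.comp_hasDerivAt (Complex.hasDerivAt_log hslit)).congr_of_eventuallyEq
    hlog).congr_deriv (by ring) (by ring)

theorem of_holomorphic (h : DifferentiableAt ℂ F x) (u : E) :
    HasWirtingerAt F x u (fderiv ℂ F x u) 0 := by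
  have h' := h.hasFDerivAt.restrictScalars ℝ
  refine ⟨h'.differentiableAt, ?_, ?_⟩ <;>
  · simp only [wirtinger, wirtingerBar, h'.fderiv, ContinuousLinearMap.coe_restrictScalars',
      map_smul, smul_eq_mul, ← mul_assoc, Complex.I_mul_I]
    ring

theorem clm (L : E →L[ℂ] ℂ) (x u : E) : HasWirtingerAt (fun y => L y) x u (L u) 0 := by
  simpa using of_holomorphic (L.differentiableAt (x := x)) u

end HasWirtingerAt

theorem wirtinger_comp {F : E → ℂ} {φ : E' → E} {y : E'} (hF : DifferentiableAt ℝ F (φ y))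
    (hφ : DifferentiableAt ℂ φ y) (u : E') :
    wirtinger (fun z => F (φ z)) y u = wirtinger F (φ y) (fderiv ℂ φ y u) := by
  have hFφ : HasFDerivAt (fun z => F (φ z)) _ y :=
    hF.hasFDerivAt.comp y (hφ.hasFDerivAt.restrictScalars ℝ)
  simp [wirtinger, hFφ.fderiv]

theorem wirtingerBar_comp {F : E → ℂ} {φ : E' → E} {y : E'} (hF : DifferentiableAt ℝ F (φ y))
    (hφ : DifferentiableAt ℂ φ y) (u : E') :
    wirtingerBar (fun z => F (φ z)) y u = wirtingerBar F (φ y) (fderiv ℂ φ y u) := by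
  have hFφ : HasFDerivAt (fun z => F (φ z)) _ y :=
    hF.hasFDerivAt.comp y (hφ.hasFDerivAt.restrictScalars ℝ)
  simp [wirtingerBar, hFφ.fderiv]

theorem wirtinger_diag {F : E → E → ℂ} {x : E}
    (hF : DifferentiableAt ℝ (fun p : E × E => F p.1 p.2) (x, x)) (u : E) :
    wirtinger (fun y => F y y) x u =
      wirtinger (fun y => F y x) x u + wirtinger (fun y => F x y) x u := by
  have hcomp {f : E → E × E} {f' : E →L[ℝ] E × E} (hf : HasFDerivAt f f' x) (hfx : f x = (x, x)) :
      fderiv ℝ (fun y => F (f y).1 (f y).2) x =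
        (fderiv ℝ (fun p : E × E => F p.1 p.2) (x, x)).comp f' :=
    (HasFDerivAt.comp (g := fun p : E × E => F p.1 p.2) x (hfx ▸ hF.hasFDerivAt) hf).fderiv
  have hid := hasFDerivAt_id (𝕜 := ℝ) x
  have hconst := hasFDerivAt_const (𝕜 := ℝ) x x
  have hsplit (v : E) : ((v, v) : E × E) = (v, 0) + (0, v) := by simp
  have hdiag := hcomp (hid.prodMk hid) rfl
  have hfst := hcomp (hid.prodMk hconst) rfl
  have hsnd := hcomp (hconst.prodMk hid) rfl
  simp only [id] at hdiag hfst hsnd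
  simp only [wirtinger, hdiag, hfst, hsnd, ContinuousLinearMap.comp_apply,
    ContinuousLinearMap.prod_apply, ContinuousLinearMap.id_apply, zero_apply]
  rw [hsplit u, hsplit (Complex.I • u), map_add, map_add]
  ring

/-- The `ℂ`-linear form `u ↦ ∂_u F` at `x`. -/
noncomputable def wirtingerCLM (F : E → ℂ) (x : E) : E →L[ℂ] ℂ where
  toFun := wirtinger F x
  map_add' := wirtinger_add_right F x
  map_smul' := wirtinger_smul_right F x
  cont := by unfold wirtinger; fun_prop

@[simp] theorem wirtingerCLM_apply (F : E → ℂ) (x u : E) : wirtingerCLM F x u = wirtinger F x u :=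
  rfl

theorem wirtinger_wirtingerBar_apply (F : E → ℂ) (x : E) {w : E' → E} {y : E'}
    (hw : DifferentiableAt ℂ w y) (u : E') :
    wirtinger (fun z => wirtingerBar F x (w z)) y u = 0 := by
  have hhol : DifferentiableAt ℂ (fun z => wirtingerCLM (fun y => conj (F y)) x (w z)) y :=
    (wirtingerCLM _ x).differentiableAt.comp y hw
  simpa [wirtinger_conj] using (HasWirtingerAt.of_holomorphic hhol u).star.wirtinger_eq

theorem contDiffAt_wirtinger {F : E → ℂ} {x : E} {m n : WithTop ℕ∞} (hF : ContDiffAt ℝ n F x)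
    (h : m + 1 ≤ n) (u : E) : ContDiffAt ℝ m (fun y => wirtinger F y u) x := by
  have := hF.fderiv_right h
  unfold wirtinger
  fun_prop

theorem contDiffAt_wirtingerBar {F : E → ℂ} {x : E} {m n : WithTop ℕ∞} (hF : ContDiffAt ℝ n F x)
    (h : m + 1 ≤ n) (u : E) : ContDiffAt ℝ m (fun y => wirtingerBar F y u) x := by
  have := hF.fderiv_right h
  unfold wirtingerBar
  fun_prop

theorem contDiffAt_ddbar {F : E → ℂ} {x : E} {m n : WithTop ℕ∞} (hF : ContDiffAt ℝ n F x)
    (h : m + 2 ≤ n) (u v : E) : ContDiffAt ℝ m (fun y => ddbar F y u v) x := by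
  rw [← one_add_one_eq_two, ← add_assoc] at h
  exact contDiffAt_wirtinger (contDiffAt_wirtingerBar hF h v) le_rfl u

section SecondOrder

variable {F : E → ℂ} {x : E}

theorem fderiv_wirtinger (hF : ContDiffAt ℝ 2 F x) (u c : E) :
    fderiv ℝ (fun y => wirtinger F y u) x c = (fderiv ℝ (fderiv ℝ F) x c u
      - Complex.I * fderiv ℝ (fderiv ℝ F) x c (Complex.I • u)) / 2 := by
  have hF' : HasFDerivAt (fderiv ℝ F) _ x :=
    ((hF.fderiv_right (m := 1) le_rfl).differentiableAt one_ne_zero).hasFDerivAt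
  have hw : HasFDerivAt (fun y => wirtinger F y u) _ x :=
    ((hF'.clm_apply (hasFDerivAt_const u x)).fun_sub
      ((hF'.clm_apply (hasFDerivAt_const (Complex.I • u) x)).const_mul Complex.I)).mul_const 2⁻¹
  simp only [hw.fderiv, ContinuousLinearMap.comp_zero, zero_add, smul_apply, sub_apply,
    ContinuousLinearMap.flip_apply, smul_eq_mul]
  ring

theorem fderiv_wirtingerBar (hF : ContDiffAt ℝ 2 F x) (u c : E) :
    fderiv ℝ (fun y => wirtingerBar F y u) x c = (fderiv ℝ (fderiv ℝ F) x c u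
      + Complex.I * fderiv ℝ (fderiv ℝ F) x c (Complex.I • u)) / 2 := by
  have hF' : HasFDerivAt (fderiv ℝ F) _ x :=
    ((hF.fderiv_right (m := 1) le_rfl).differentiableAt one_ne_zero).hasFDerivAt
  have hw : HasFDerivAt (fun y => wirtingerBar F y u) _ x :=
    ((hF'.clm_apply (hasFDerivAt_const u x)).fun_add
      ((hF'.clm_apply (hasFDerivAt_const (Complex.I • u) x)).const_mul Complex.I)).mul_const 2⁻¹
  simp only [hw.fderiv, ContinuousLinearMap.comp_zero, zero_add, smul_add, add_apply, smul_apply,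
    ContinuousLinearMap.flip_apply, smul_eq_mul]
  ring

theorem fderiv_fderiv_comm (hF : ContDiffAt ℝ 2 F x) (u v : E) :
    fderiv ℝ (fderiv ℝ F) x u v = fderiv ℝ (fderiv ℝ F) x v u :=
  hF.isSymmSndFDerivAt (by simp) u v

theorem wirtinger_wirtinger_comm (hF : ContDiffAt ℝ 2 F x) (u v : E) :
    wirtinger (fun y => wirtinger F y v) x u = wirtinger (fun y => wirtinger F y u) x v := by
  rw [wirtinger, wirtinger, fderiv_wirtinger hF, fderiv_wirtinger hF, fderiv_wirtinger hF,
    fderiv_wirtinger hF, fderiv_fderiv_comm hF v u, fderiv_fderiv_comm hF v (Complex.I • u),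
    fderiv_fderiv_comm hF (Complex.I • v) u, fderiv_fderiv_comm hF (Complex.I • v) (Complex.I • u)]
  ring

theorem wirtingerBar_wirtinger (hF : ContDiffAt ℝ 2 F x) (u v : E) :
    wirtingerBar (fun y => wirtinger F y u) x v = ddbar F x u v := by
  rw [ddbar, wirtinger, wirtingerBar, fderiv_wirtinger hF, fderiv_wirtinger hF,
    fderiv_wirtingerBar hF, fderiv_wirtingerBar hF, fderiv_fderiv_comm hF v u,
    fderiv_fderiv_comm hF v (Complex.I • u), fderiv_fderiv_comm hF (Complex.I • v) u,
    fderiv_fderiv_comm hF (Complex.I • v) (Complex.I • u)]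
  ring

theorem hasWirtingerAt_wirtinger (hF : ContDiffAt ℝ 2 F x) (u c : E) :
    HasWirtingerAt (fun y => wirtinger F y u) x c (wirtinger (fun y => wirtinger F y u) x c)
      (ddbar F x u c) :=
  ⟨(contDiffAt_wirtinger hF (m := 1) le_rfl u).differentiableAt one_ne_zero, rfl,
    wirtingerBar_wirtinger hF u c⟩

theorem ddbar_eq_fderiv_fderiv (hF : ContDiffAt ℝ 2 F x) (u v : E) :
    ddbar F x u v = (fderiv ℝ (fderiv ℝ F) x u v
      + Complex.I * fderiv ℝ (fderiv ℝ F) x u (Complex.I • v)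
      - Complex.I * fderiv ℝ (fderiv ℝ F) x (Complex.I • u) v
      + fderiv ℝ (fderiv ℝ F) x (Complex.I • u) (Complex.I • v)) / 4 := by
  rw [ddbar, wirtinger, fderiv_wirtingerBar hF, fderiv_wirtingerBar hF]
  linear_combination (-(fderiv ℝ (fderiv ℝ F) x (Complex.I • u) (Complex.I • v)) / 4) *
    Complex.I_mul_I

theorem ddbar_add_left (F : E → ℂ) (x u u' v : E) :
    ddbar F x (u + u') v = ddbar F x u v + ddbar F x u' v := wirtinger_add_right _ _ _ _

theorem ddbar_smul_left (F : E → ℂ) (x : E) (c : ℂ) (u v : E) :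
    ddbar F x (c • u) v = c * ddbar F x u v := wirtinger_smul_right _ _ _ _

theorem conj_ddbar_ofReal {f : E → ℝ} (hf : ContDiffAt ℝ 2 (fun y => (f y : ℂ)) x) (u v : E) :
    conj (ddbar (fun y => (f y : ℂ)) x u v) = ddbar (fun y => (f y : ℂ)) x v u := by
  rw [← wirtingerBar_wirtinger hf v u, ddbar, ← wirtingerBar_conj]
  simp only [conj_wirtingerBar_ofReal]

/-- The second derivatives of `φ` do not enter: they are paired with `∂̄F`, and `∂̄F(φ y)` of a
holomorphic vector field is antiholomorphic. -/
theorem ddbar_comp {φ : E' → E} {y : E'} (hF : ContDiffAt ℝ 2 F (φ y))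
    (hφ : ContDiffAt ℂ 2 φ y) (u v : E') :
    ddbar (fun z => F (φ z)) y u v = ddbar F (φ y) (fderiv ℂ φ y u) (fderiv ℂ φ y v) := by
  have hφ' : DifferentiableAt ℂ φ y := hφ.differentiableAt two_ne_zero
  have hbar : (fun z => wirtingerBar (fun z => F (φ z)) z v) =ᶠ[𝓝 y]
      fun z => wirtingerBar F (φ z) (fderiv ℂ φ z v) := by
    filter_upwards [hφ.continuousAt.eventually (hF.eventually (by simp)),
      hφ.eventually (by simp)] with z hFz hφz
    exact wirtingerBar_comp (hFz.differentiableAt two_ne_zero) (hφz.differentiableAt two_ne_zero) v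
  have hφv : DifferentiableAt ℂ (fun z => fderiv ℂ φ z v) y :=
    ((hφ.fderiv_right (m := 1) le_rfl).differentiableAt one_ne_zero).clm_apply
      (differentiableAt_const v)
  have hdiff : DifferentiableAt ℝ
      (fun z : E' × E' => wirtingerBar F (φ z.1) (fderiv ℂ φ z.2 v)) (y, y) := by
    have hF' : DifferentiableAt ℝ (fun z : E' × E' => fderiv ℝ F (φ z.1)) (y, y) :=
      ((hF.fderiv_right (m := 1) le_rfl).differentiableAt one_ne_zero).comp (y, y)
        ((hφ'.restrictScalars ℝ).comp (y, y) differentiableAt_fst)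
    have hw : DifferentiableAt ℝ (fun z : E' × E' => fderiv ℂ φ z.2 v) (y, y) :=
      DifferentiableAt.comp (g := fun z => fderiv ℂ φ z v) (y, y) (hφv.restrictScalars ℝ)
        differentiableAt_snd
    unfold wirtingerBar
    fun_prop
  have hdiag := wirtinger_diag (F := fun z z' => wirtingerBar F (φ z) (fderiv ℂ φ z' v)) hdiff u
  rw [ddbar, wirtinger_congr hbar, hdiag, wirtinger_wirtingerBar_apply _ _ hφv,
    add_zero, ddbar]
  exact wirtinger_comp ((contDiffAt_wirtingerBar hF le_rfl _).differentiableAt one_ne_zero) hφ' u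

end SecondOrder

end WirtingerDerivatives

section PotentialForm

variable {E : Type*} [NormedAddCommGroup E] [NormedSpace ℂ E]
  {E' : Type*} [NormedAddCommGroup E'] [NormedSpace ℂ E']

/-- The form `∑ (∂²φ/∂z_j∂z̄_k) u_j v̄_k` at `y`: the coefficients of the metric with Kähler
potential `φ`. -/
noncomputable def potentialForm (φ : E → ℝ) (y u v : E) : ℂ :=
  ddbar (fun z => (φ z : ℂ)) y u v

variable {φ χ : E → ℝ} {x : E}

theorem contDiffAt_ofReal {n : WithTop ℕ∞} (hφ : ContDiffAt ℝ n φ x) :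
    ContDiffAt ℝ n (fun y => (φ y : ℂ)) x :=
  Complex.ofRealCLM.contDiff.contDiffAt.comp x hφ

theorem potentialForm_congr (h : φ =ᶠ[𝓝 x] χ) : potentialForm φ x = potentialForm χ x := by
  ext u v
  exact ddbar_congr (h.mono fun y hy => congrArg _ hy) u v

theorem contDiffAt_potentialForm {m n : WithTop ℕ∞} (hφ : ContDiffAt ℝ n φ x) (h : m + 2 ≤ n)
    (u v : E) : ContDiffAt ℝ m (fun y => potentialForm φ y u v) x :=
  contDiffAt_ddbar (contDiffAt_ofReal hφ) h u v

theorem potentialForm_add_left (φ : E → ℝ) (x u u' v : E) :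
    potentialForm φ x (u + u') v = potentialForm φ x u v + potentialForm φ x u' v :=
  ddbar_add_left _ _ _ _ _

theorem potentialForm_zero_left (φ : E → ℝ) (x v : E) : potentialForm φ x 0 v = 0 :=
  wirtinger_zero_right _ x

theorem potentialForm_smul_left (φ : E → ℝ) (x : E) (c : ℂ) (u v : E) :
    potentialForm φ x (c • u) v = c * potentialForm φ x u v :=
  ddbar_smul_left _ _ _ _ _

theorem conj_potentialForm (hφ : ContDiffAt ℝ 2 φ x) (u v : E) :
    conj (potentialForm φ x u v) = potentialForm φ x v u :=
  conj_ddbar_ofReal (contDiffAt_ofReal hφ) u v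

theorem potentialForm_add_right (hφ : ContDiffAt ℝ 2 φ x) (u v v' : E) :
    potentialForm φ x u (v + v') = potentialForm φ x u v + potentialForm φ x u v' := by
  simp only [← conj_potentialForm hφ _ u, potentialForm_add_left, map_add]

theorem potentialForm_smul_right (hφ : ContDiffAt ℝ 2 φ x) (c : ℂ) (u v : E) :
    potentialForm φ x u (c • v) = conj c * potentialForm φ x u v := by
  simp only [← conj_potentialForm hφ _ u, potentialForm_smul_left, map_mul]

theorem potentialForm_neg (φ : E → ℝ) (x u v : E) :
    potentialForm (fun y => -φ y) x u v = -potentialForm φ x u v := by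
  have hbar (y : E) : wirtingerBar (fun z => ((-φ z : ℝ) : ℂ)) y v =
      -wirtingerBar (fun z => (φ z : ℂ)) y v := by
    simp only [wirtingerBar, Complex.ofReal_neg, fderiv_fun_neg, neg_apply]
    ring
  simp only [potentialForm, ddbar, hbar, wirtinger, fderiv_fun_neg, neg_apply]
  ring

theorem potentialForm_sub (hφ : ContDiffAt ℝ 2 φ x) (hχ : ContDiffAt ℝ 2 χ x) (u v : E) :
    potentialForm (fun y => φ y - χ y) x u v = potentialForm φ x u v - potentialForm χ x u v := by
  have hfirst {ρ : E → ℝ} {y : E} (hρ : ContDiffAt ℝ 2 ρ y) :=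
    HasWirtingerAt.of_differentiableAt ((contDiffAt_ofReal hρ).differentiableAt two_ne_zero) v
  have hsecond {ρ : E → ℝ} (hρ : ContDiffAt ℝ 2 ρ x) :=
    HasWirtingerAt.of_differentiableAt ((contDiffAt_wirtingerBar (contDiffAt_ofReal hρ)
      (m := 1) le_rfl v).differentiableAt one_ne_zero) u
  have hbar : (fun y => wirtingerBar (fun z => ((φ z - χ z : ℝ) : ℂ)) y v) =ᶠ[𝓝 x]
      fun y => wirtingerBar (fun z => (φ z : ℂ)) y v - wirtingerBar (fun z => (χ z : ℂ)) y v := by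
    filter_upwards [hφ.eventually (by simp), hχ.eventually (by simp)] with y hφy hχy
    simpa only [Complex.ofReal_sub] using ((hfirst hφy).sub (hfirst hχy)).wirtingerBar_eq
  exact (wirtinger_congr hbar u).trans ((hsecond hφ).sub (hsecond hχ)).wirtinger_eq

theorem hasWirtingerAt_norm_sq {c : E → ℂ} {y : E} (hc : DifferentiableAt ℂ c y) (v : E) :
    HasWirtingerAt (fun z => ((‖c z‖ ^ 2 : ℝ) : ℂ)) y v (fderiv ℂ c y v * conj (c y))
      (c y * conj (fderiv ℂ c y v)) := by
  have hhol := HasWirtingerAt.of_holomorphic hc v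
  simpa [Complex.mul_conj, Complex.normSq_eq_norm_sq] using hhol.mul hhol.star

theorem contDiffAt_log_norm_sq {n : WithTop ℕ∞} {c : E → ℂ} (hc : ContDiffAt ℂ n c x)
    (hc0 : c x ≠ 0) : ContDiffAt ℝ n (fun y => Real.log (‖c y‖ ^ 2)) x :=
  ((hc.restrict_scalars ℝ).norm_sq ℝ).log (by positivity)

/-- `log |c|²` is pluriharmonic for holomorphic `c`: its `∂̄`-derivative is the conjugate of the
holomorphic function `dc / c`. -/
theorem potentialForm_log_norm_sq {c : E → ℂ} (hc : ContDiffAt ℂ 2 c x) (hc0 : c x ≠ 0)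
    (u v : E) : potentialForm (fun y => Real.log (‖c y‖ ^ 2)) x u v = 0 := by
  have hbar : (fun y => wirtingerBar (fun z => (Real.log (‖c z‖ ^ 2) : ℂ)) y v) =ᶠ[𝓝 x]
      fun y => conj (fderiv ℂ c y v / c y) := by
    filter_upwards [hc.eventually (by simp), hc.continuousAt.eventually_ne hc0] with y hcy hcy0
    have hconj : conj (c y) ≠ 0 := (map_ne_zero _).2 hcy0
    have hsq : ((‖c y‖ ^ 2 : ℝ) : ℂ) = c y * conj (c y) := by
      simp [Complex.mul_conj, Complex.normSq_eq_norm_sq]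
    rw [((hasWirtingerAt_norm_sq (hcy.differentiableAt two_ne_zero) v).log
      (by positivity)).wirtingerBar_eq, hsq, map_div₀]
    field_simp
  have hhol : DifferentiableAt ℂ (fun y => fderiv ℂ c y v / c y) x := by
    simp only [div_eq_mul_inv]
    exact (((hc.fderiv_right (m := 1) le_rfl).differentiableAt one_ne_zero).clm_apply
      (differentiableAt_const v)).mul
      ((hc.differentiableAt two_ne_zero).inv hc0)
  rw [potentialForm, ddbar, wirtinger_congr hbar, wirtinger_conj,
    (HasWirtingerAt.of_holomorphic hhol u).wirtingerBar_eq, map_zero]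

theorem potentialForm_comp {ψ : E' → E} {y : E'} (hφ : ContDiffAt ℝ 2 φ (ψ y))
    (hψ : ContDiffAt ℂ 2 ψ y) (u v : E') :
    potentialForm (fun z => φ (ψ z)) y u v =
      potentialForm φ (ψ y) (fderiv ℂ ψ y u) (fderiv ℂ ψ y v) :=
  ddbar_comp (contDiffAt_ofReal hφ) hψ u v

theorem wirtinger_potentialForm_comm (hφ : ContDiffAt ℝ 3 φ x) (a b c : E) :
    wirtinger (fun y => potentialForm φ y a b) x c =
      wirtinger (fun y => potentialForm φ y c b) x a :=
  wirtinger_wirtinger_comm (contDiffAt_wirtingerBar (contDiffAt_ofReal hφ) (by norm_num) b) c a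

theorem wirtingerBar_potentialForm (hφ : ContDiffAt ℝ 2 φ x) (a b c : E) :
    wirtingerBar (fun y => potentialForm φ y a b) x c =
      conj (wirtinger (fun y => potentialForm φ y b a) x c) := by
  rw [← wirtingerBar_conj]
  exact wirtingerBar_congr ((hφ.eventually (by simp)).mono fun y hy =>
    (conj_potentialForm hy b a).symm) c

theorem hasWirtingerAt_potentialForm (hφ : ContDiffAt ℝ 3 φ x) (a b c : E) :
    HasWirtingerAt (fun y => potentialForm φ y a b) x c
      (wirtinger (fun y => potentialForm φ y a b) x c)
      (conj (wirtinger (fun y => potentialForm φ y b a) x c)) :=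
  ⟨(contDiffAt_potentialForm hφ (m := 1) (by norm_num) a b).differentiableAt one_ne_zero, rfl,
    wirtingerBar_potentialForm (hφ.of_le (by norm_num)) a b c⟩

theorem wirtinger_potentialForm_add_right (hφ : ContDiffAt ℝ 3 φ x) (a b b' c : E) :
    wirtinger (fun y => potentialForm φ y a (b + b')) x c =
      wirtinger (fun y => potentialForm φ y a b) x c +
        wirtinger (fun y => potentialForm φ y a b') x c := by
  rw [← ((hasWirtingerAt_potentialForm hφ a b c).add
    (hasWirtingerAt_potentialForm hφ a b' c)).wirtinger_eq]
  exact wirtinger_congr ((hφ.eventually (by simp)).mono fun y hy =>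
    potentialForm_add_right (hy.of_le (by norm_num)) a b b') c

theorem wirtinger_potentialForm_smul_right (hφ : ContDiffAt ℝ 3 φ x) (k : ℂ) (a b c : E) :
    wirtinger (fun y => potentialForm φ y a (k • b)) x c =
      conj k * wirtinger (fun y => potentialForm φ y a b) x c := by
  have hmul := ((HasWirtingerAt.const (conj k) x c).mul
    (hasWirtingerAt_potentialForm hφ a b c)).wirtinger_eq
  rw [zero_mul, zero_add] at hmul
  rw [← hmul]
  exact wirtinger_congr ((hφ.eventually (by simp)).mono fun y hy =>
    potentialForm_smul_right (hy.of_le (by norm_num)) k a b) c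

theorem differentiableAt_potentialForm_apply {X : Type*} [NormedAddCommGroup X] [NormedSpace ℝ X]
    {ψ V W : X → E} {z : X} (hφ : ContDiffAt ℝ 3 φ (ψ z)) (hψ : DifferentiableAt ℝ ψ z)
    (hV : DifferentiableAt ℝ V z) (hW : DifferentiableAt ℝ W z) :
    DifferentiableAt ℝ (fun z => potentialForm φ (ψ z) (V z) (W z)) z := by
  let F : E → ℂ := fun y => φ y
  have hF : ContDiffAt ℝ 3 F (ψ z) := contDiffAt_ofReal hφ
  have hD2 : DifferentiableAt ℝ (fun z => fderiv ℝ (fderiv ℝ F) (ψ z)) z :=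
    (((hF.fderiv_right (m := 2) (by norm_num)).fderiv_right (m := 1) (by norm_num)).differentiableAt
      one_ne_zero).comp z hψ
  have hformula : (fun z => potentialForm φ (ψ z) (V z) (W z)) =ᶠ[𝓝 z] fun z => _ :=
    (hψ.continuousAt.eventually (hF.eventually (by simp))).mono fun y hy =>
      ddbar_eq_fderiv_fderiv (hy.of_le (by norm_num)) (V y) (W y)
  refine DifferentiableAt.congr_of_eventuallyEq ?_ hformula
  fun_prop

theorem hasWirtingerAt_potentialForm_left {V : E' → E} {y : E'} (hV : DifferentiableAt ℂ V y)
    (b : E) (c : E') :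
    HasWirtingerAt (fun z => potentialForm φ x (V z) b) y c
      (potentialForm φ x (fderiv ℂ V y c) b) 0 := by
  let L := wirtingerCLM (fun y => wirtingerBar (fun z => (φ z : ℂ)) y b) x
  have hL : HasFDerivAt (fun z => L (V z)) (L.comp (fderiv ℂ V y)) y :=
    L.hasFDerivAt.comp y hV.hasFDerivAt
  exact (HasWirtingerAt.of_holomorphic hL.differentiableAt c).congr_deriv (by rw [hL.fderiv]; rfl)
    rfl

theorem wirtinger_potentialForm_apply {ψ V W : E' → E} {y : E'} (hφ : ContDiffAt ℝ 3 φ (ψ y))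
    (hψ : DifferentiableAt ℂ ψ y) (hV : DifferentiableAt ℂ V y) (hW : DifferentiableAt ℂ W y)
    (c : E') :
    wirtinger (fun z => potentialForm φ (ψ z) (V z) (W z)) y c =
      wirtinger (fun z => potentialForm φ z (V y) (W y)) (ψ y) (fderiv ℂ ψ y c) +
        potentialForm φ (ψ y) (fderiv ℂ V y c) (W y) := by
  have hψ' := hψ.restrictScalars ℝ
  have hV' := hV.restrictScalars ℝ
  have hW' := hW.restrictScalars ℝ
  have hpoint := wirtinger_diag (F := fun z z' => potentialForm φ (ψ z) (V z') (W z'))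
    (differentiableAt_potentialForm_apply hφ (hψ'.fun_comp' (y, y) differentiableAt_fst)
      (hV'.fun_comp' (y, y) differentiableAt_snd) (hW'.fun_comp' (y, y) differentiableAt_snd)) c
  have hvectors := wirtinger_diag (F := fun z z' => potentialForm φ (ψ y) (V z) (W z'))
    (differentiableAt_potentialForm_apply hφ (differentiableAt_const _)
      (hV'.fun_comp' (y, y) differentiableAt_fst) (hW'.fun_comp' (y, y) differentiableAt_snd)) c
  have hφ2 : ContDiffAt ℝ 2 φ (ψ y) := hφ.of_le (by norm_num)
  have hright : wirtinger (fun z => potentialForm φ (ψ y) (V y) (W z)) y c = 0 := by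
    simpa only [conj_potentialForm hφ2, map_zero] using
      (hasWirtingerAt_potentialForm_left (φ := φ) (x := ψ y) hW (V y) c).star.wirtinger_eq
  have hleft : wirtinger (fun z => potentialForm φ (ψ y) (V z) (W y)) y c =
      potentialForm φ (ψ y) (fderiv ℂ V y c) (W y) :=
    (hasWirtingerAt_potentialForm_left hV (W y) c).wirtinger_eq
  have hbase := wirtinger_comp (F := fun z => potentialForm φ z (V y) (W y))
    ((contDiffAt_potentialForm hφ (m := 1) (by norm_num) _ _).differentiableAt one_ne_zero) hψ c
  rw [hpoint, hvectors, hleft, hright, hbase, add_zero]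

end PotentialForm

namespace IsHermitianInner

variable {V : Type*} [AddCommGroup V] [Module ℂ V] {g : V → V → ℂ} (hg : IsHermitianInner g)
include hg

theorem zero_left (w : V) : g 0 w = 0 := by
  simpa using hg.smul_left 0 0 w

theorem sub_left (u v w : V) : g (u - v) w = g u w - g v w := by
  rw [sub_eq_add_neg, ← neg_one_smul ℂ v, hg.add_left, hg.smul_left]
  ring

theorem add_right (u v w : V) : g u (v + w) = g u v + g u w := by
  rw [hg.conj_symm, hg.add_left, map_add, ← hg.conj_symm, ← hg.conj_symm]

theorem smul_right (c : ℂ) (u w : V) : g u (c • w) = conj c * g u w := by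
  rw [hg.conj_symm, hg.smul_left, map_mul, ← hg.conj_symm]

theorem sum_smul_left {ι : Type*} (s : Finset ι) (c : ι → ℂ) (f : ι → V) (w : V) :
    g (∑ i ∈ s, c i • f i) w = ∑ i ∈ s, c i * g (f i) w := by
  simp only [← hg.smul_left]
  exact map_sum (AddMonoidHom.mk' (fun u => g u w) fun u v => hg.add_left u v w) _ s

theorem sum_smul_right {ι : Type*} (s : Finset ι) (c : ι → ℂ) (f : ι → V) (w : V) :
    g w (∑ i ∈ s, c i • f i) = ∑ i ∈ s, conj (c i) * g w (f i) := by
  simp only [← hg.smul_right]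
  exact map_sum (AddMonoidHom.mk' (fun u => g w u) fun u v => hg.add_right w u v) _ s

theorem ofReal_re_self (u : V) : ((g u u).re : ℂ) = g u u :=
  Complex.conj_eq_iff_re.1 (hg.conj_symm u u).symm

theorem eq_zero_of_apply_self {u : V} (h : g u u = 0) : u = 0 := by
  by_contra hu
  simpa [h] using hg.pos u hu

theorem eq_of_forall_apply_eq {u v : V} (h : ∀ w, g u w = g v w) : u = v :=
  sub_eq_zero.1 (hg.eq_zero_of_apply_self (by rw [hg.sub_left, h, sub_self]))

theorem re_apply_self_nonneg (u : V) : 0 ≤ (g u u).re := by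
  by_cases hu : u = 0
  · simp [hu, hg.zero_left]
  · exact (hg.pos u hu).le

theorem exists_orthonormal_basis [FiniteDimensional ℂ V] :
    ∃ e : Module.Basis (Fin (Module.finrank ℂ V)) ℂ V,
      ∀ i j, g (e i) (e j) = if i = j then 1 else 0 := by
  let core : InnerProductSpace.Core ℂ V :=
    { inner := fun u w => g w u
      conj_inner_symm := fun u w => (hg.conj_symm u w).symm
      re_inner_nonneg := hg.re_apply_self_nonneg
      add_left := fun u v w => hg.add_right w u v
      smul_left := fun u w c => hg.smul_right c w u
      definite := fun _ => hg.eq_zero_of_apply_self }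
  let _ : NormedAddCommGroup V := core.toNormedAddCommGroup
  let _ : InnerProductSpace ℂ V := InnerProductSpace.ofCore core.toCore
  refine ⟨(stdOrthonormalBasis ℂ V).toBasis, fun i j => ?_⟩
  have horth := orthonormal_iff_ite.1 (stdOrthonormalBasis ℂ V).orthonormal j i
  rw [OrthonormalBasis.coe_toBasis]
  exact horth.trans (if_congr eq_comm rfl rfl)

theorem exists_bilin_eq [FiniteDimensional ℂ V] {β : V → V → V → ℂ}
    (hadd₁ : ∀ c c' a d, β (c + c') a d = β c a d + β c' a d)
    (hsmul₁ : ∀ (k : ℂ) c a d, β (k • c) a d = k * β c a d)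
    (hadd₂ : ∀ c a a' d, β c (a + a') d = β c a d + β c a' d)
    (hsmul₂ : ∀ (k : ℂ) c a d, β c (k • a) d = k * β c a d)
    (hadd₃ : ∀ c a d d', β c a (d + d') = β c a d + β c a d')
    (hsmul₃ : ∀ (k : ℂ) c a d, β c a (k • d) = conj k * β c a d) :
    ∃ B : V →ₗ[ℂ] V →ₗ[ℂ] V, ∀ c a d, g (B c a) d = β c a d := by
  obtain ⟨e, he⟩ := hg.exists_orthonormal_basis
  refine ⟨LinearMap.mk₂ ℂ (fun c a => ∑ i, β c a (e i) • e i) ?_ ?_ ?_ ?_, fun c a d => ?_⟩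
  · simp only [hadd₁, add_smul, Finset.sum_add_distrib, implies_true]
  · simp only [hsmul₁, mul_smul, Finset.smul_sum, implies_true]
  · simp only [hadd₂, add_smul, Finset.sum_add_distrib, implies_true]
  · simp only [hsmul₂, mul_smul, Finset.smul_sum, implies_true]
  · have hβ : β c a (∑ i, e.repr d i • e i) = ∑ i, conj (e.repr d i) * β c a (e i) := by
      simp only [← hsmul₃]
      exact map_sum (AddMonoidHom.mk' (β c a) (hadd₃ c a)) _ _
    have hcoord (i) : g (e i) d = conj (e.repr d i) := by
      conv_lhs => rw [← e.sum_repr d]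
      simp [hg.sum_smul_right, he, -Module.Basis.sum_repr]
    conv_rhs => rw [← e.sum_repr d, hβ]
    simp only [LinearMap.mk₂_apply, hg.sum_smul_left, hcoord, mul_comm]

end IsHermitianInner

theorem IsHermitianInner.exists_euclidean_equiv {E : Type*} [NormedAddCommGroup E] [NormedSpace ℂ E]
    [FiniteDimensional ℂ E] {m : ℕ} {g : E → E → ℂ} (hg : IsHermitianInner g)
    (hm : Module.finrank ℂ E = m) :
    ∃ A : EuclideanSpace ℂ (Fin m) ≃L[ℂ] E, ∀ a b, g (A a) (A b) = ∑ j, a j * conj (b j) := by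
  subst hm
  obtain ⟨e, he⟩ := hg.exists_orthonormal_basis
  let A := (WithLp.linearEquiv 2 ℂ (Fin (Module.finrank ℂ E) → ℂ)).trans e.equivFun.symm
  have hA (a) : A a = ∑ i, a i • e i := by simp [A, Module.Basis.equivFun_symm_apply]
  exact ⟨A.toContinuousLinearEquiv, fun a b => by
    simp [hA, hg.sum_smul_left, hg.sum_smul_right, he]⟩

section Curvature

variable {E : Type*} [NormedAddCommGroup E] [NormedSpace ℂ E] [FiniteDimensional ℂ E]

theorem vecMul_metricMatrix {g : E → E → ℂ} (hg : IsHermitianInner g)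
    (c : Fin (Module.finrank ℂ E) → ℂ) (k : Fin (Module.finrank ℂ E)) :
    Matrix.vecMul c (metricMatrix g) k =
      g (∑ i, c i • Module.finBasis ℂ E i) (Module.finBasis ℂ E k) := by
  simp [Matrix.vecMul, dotProduct, metricMatrix, hg.sum_smul_left]

theorem dotProduct_vecMul_metricMatrix {g : E → E → ℂ} (hg : IsHermitianInner g)
    (c : Fin (Module.finrank ℂ E) → ℂ) :
    dotProduct c (star (Matrix.vecMul c (metricMatrix g))) =
      g (∑ i, c i • Module.finBasis ℂ E i) (∑ i, c i • Module.finBasis ℂ E i) := by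
  conv_rhs => rw [hg.sum_smul_left]
  refine Finset.sum_congr rfl fun i _ => ?_
  rw [Pi.star_apply, vecMul_metricMatrix hg, ← starRingEnd_apply, ← hg.conj_symm]

theorem isUnit_metricMatrix {g : E → E → ℂ} (hg : IsHermitianInner g) :
    IsUnit (metricMatrix g) := by
  rw [← Matrix.vecMul_injective_iff_isUnit]
  refine (injective_iff_map_eq_zero (Matrix.vecMulLinear (metricMatrix g))).2 fun c hc => ?_
  have hc' : Matrix.vecMul c (metricMatrix g) = 0 := hc
  have hsum : ∑ i, c i • Module.finBasis ℂ E i = 0 :=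
    hg.eq_zero_of_apply_self (by rw [← dotProduct_vecMul_metricMatrix hg, hc']; simp)
  exact funext fun i =>
    Fintype.linearIndependent_iff.1 (Module.finBasis ℂ E).linearIndependent c hsum i

/-- If `w` represents the row `∂_u g(u, ·)` then the Chern connection term of the curvature is
`g(w, w̄)`, so no matrix inverse has to be computed. -/
theorem curvatureQuartic_eq {G : E → E → E → ℂ} {x : E} (hG : IsHermitianInner (G x)) {u w : E}
    (hw : ∀ b, wirtinger (fun y => G y u b) x u = G x w b) :
    curvatureQuartic G x u = G x w w - ddbar (fun y => G y u u) x u u := by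
  have hrow : (fun k => wirtinger (fun y => G y u (Module.finBasis ℂ E k)) x u) =
      Matrix.vecMul ((Module.finBasis ℂ E).repr w) (metricMatrix (G x)) := by
    funext k
    rw [vecMul_metricMatrix hG, (Module.finBasis ℂ E).sum_repr, hw]
  have hdet := (Matrix.isUnit_iff_isUnit_det _).1 (isUnit_metricMatrix hG)
  rw [curvatureQuartic, hrow, Matrix.vecMul_vecMul, Matrix.mul_nonsing_inv _ hdet,
    Matrix.vecMul_one, dotProduct_vecMul_metricMatrix hG, (Module.finBasis ℂ E).sum_repr]

theorem holSectCurvCoord_congr {G G' : E → E → E → ℂ} {x : E} (h : G =ᶠ[𝓝 x] G') (u : E) :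
    holSectCurvCoord G x u = holSectCurvCoord G' x u := by
  have happly (a b : E) : (fun y => G y a b) =ᶠ[𝓝 x] fun y => G' y a b :=
    h.mono fun y hy => congrFun₂ hy a b
  simp only [holSectCurvCoord, curvatureQuartic, h.self_of_nhds, wirtinger_congr (happly _ _),
    ddbar_congr (happly _ _)]

/-- `B` is the quadratic form of Christoffel symbols of the metric with potential `φ`; it is
symmetric because the metric is Kähler. -/
theorem exists_christoffel {φ : E → ℝ} {x : E} (hφ : ContDiffAt ℝ 3 φ x)
    (hg : IsHermitianInner (potentialForm φ x)) :
    ∃ B : E →L[ℂ] E →L[ℂ] E, (∀ c a, B c a = B a c) ∧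
      ∀ c a d, potentialForm φ x (B c a) d = wirtinger (fun y => potentialForm φ y a d) x c := by
  have hcomm (c a d : E) := wirtinger_potentialForm_comm hφ a d c
  obtain ⟨B, hB⟩ := hg.exists_bilin_eq
    (β := fun c a d => wirtinger (fun y => potentialForm φ y a d) x c)
    (fun _ _ _ _ => wirtinger_add_right _ _ _ _) (fun _ _ _ _ => wirtinger_smul_right _ _ _ _)
    (fun c a a' d => by simp only [hcomm c, wirtinger_add_right])
    (fun k c a d => by simp only [hcomm c, wirtinger_smul_right])
    (fun c a d d' => wirtinger_potentialForm_add_right hφ a d d' c)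
    (fun k c a d => wirtinger_potentialForm_smul_right hφ k a d c)
  refine ⟨B.toContinuousBilinearMap, fun c a => ?_, hB⟩
  exact hg.eq_of_forall_apply_eq fun d => by
    simpa only [LinearMap.toContinuousBilinearMap_apply, hB] using hcomm c a d

end Curvature

section DiscPotential

variable {E : Type*} [NormedAddCommGroup E] [NormedSpace ℂ E]

/-- `1 - |v|² e^φ`, which is `1 - |η|²_{h⁻¹}` when `v` is the fibre coordinate of `η` in a frame
whose squared norm is `e^{-φ}`. -/
noncomputable def discDefect (v : E →L[ℂ] ℂ) (φ : E → ℝ) (y : E) : ℝ :=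
  1 - ‖v y‖ ^ 2 * Real.exp (φ y)

/-- The local potential `φ - log (1 - |v|² e^φ)` of the metric `g_D`. -/
noncomputable def discPotential (v : E →L[ℂ] ℂ) (φ : E → ℝ) (y : E) : ℝ :=
  φ y - Real.log (discDefect v φ y)

/-- The connection form `θ = dv + v ∂φ` of the dual line bundle. -/
noncomputable def connForm (v : E →L[ℂ] ℂ) (φ : E → ℝ) (y u : E) : ℂ :=
  v u + v y * wirtinger (fun z => (φ z : ℂ)) y u

/-- The `(1,0)`-form `κ = e^φ v̄ θ / (1 - |v|² e^φ)`, which is `-∂ log (1 - |v|² e^φ)`. -/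
noncomputable def logDefectForm (v : E →L[ℂ] ℂ) (φ : E → ℝ) (y u : E) : ℂ :=
  Real.exp (φ y) * conj (v y) * connForm v φ y u / discDefect v φ y

/-- `∂_c θ_b + (∂_c φ + 2 κ_c) θ_b`, the derivative of the connection form twisted so that
`∂_c (e^φ θ_b / (1 - |v|² e^φ)²) = e^φ (connDeriv c b) / (1 - |v|² e^φ)²`. -/
noncomputable def connDeriv (v : E →L[ℂ] ℂ) (φ : E → ℝ) (y c b : E) : ℂ :=
  v c * wirtinger (fun z => (φ z : ℂ)) y b +
    v y * wirtinger (fun y => wirtinger (fun z => (φ z : ℂ)) y b) y c +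
    (wirtinger (fun z => (φ z : ℂ)) y c + 2 * logDefectForm v φ y c) * connForm v φ y b

variable {v : E →L[ℂ] ℂ} {φ : E → ℝ} {x : E}

theorem connForm_add (v : E →L[ℂ] ℂ) (φ : E → ℝ) (x u u' : E) :
    connForm v φ x (u + u') = connForm v φ x u + connForm v φ x u' := by
  simp only [connForm, map_add, wirtinger_add_right]
  ring

theorem connForm_smul (v : E →L[ℂ] ℂ) (φ : E → ℝ) (x : E) (c : ℂ) (u : E) :
    connForm v φ x (c • u) = c * connForm v φ x u := by
  simp only [connForm, map_smul, wirtinger_smul_right, smul_eq_mul]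
  ring

theorem contDiffAt_discDefect {n : WithTop ℕ∞} (hφ : ContDiffAt ℝ n φ x) :
    ContDiffAt ℝ n (discDefect v φ) x :=
  contDiffAt_const.sub (((v.restrictScalars ℝ).contDiff.contDiffAt.norm_sq ℝ).mul hφ.exp)

theorem contDiffAt_discPotential {n : WithTop ℕ∞} (hφ : ContDiffAt ℝ n φ x)
    (hpos : 0 < discDefect v φ x) : ContDiffAt ℝ n (discPotential v φ) x :=
  hφ.sub ((contDiffAt_discDefect hφ).log hpos.ne')

theorem eventually_discDefect_pos (hφ : ContinuousAt φ x) (hpos : 0 < discDefect v φ x) :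
    ∀ᶠ y in 𝓝 x, 0 < discDefect v φ y := by
  have hcont : ContinuousAt (discDefect v φ) x := by unfold discDefect; fun_prop
  exact hcont.eventually (lt_mem_nhds hpos)

theorem hasWirtingerAt_ofReal (hφ : DifferentiableAt ℝ φ x) (u : E) :
    HasWirtingerAt (fun y => (φ y : ℂ)) x u (wirtinger (fun y => (φ y : ℂ)) x u)
      (conj (wirtinger (fun y => (φ y : ℂ)) x u)) :=
  ⟨Complex.ofRealCLM.differentiableAt.comp x hφ, rfl, (conj_wirtinger_ofReal φ x u).symm⟩

theorem hasWirtingerAt_discDefect (hφ : DifferentiableAt ℝ φ x) (u : E) :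
    HasWirtingerAt (fun y => (discDefect v φ y : ℂ)) x u
      (-(Real.exp (φ x) * conj (v x) * connForm v φ x u))
      (-conj (Real.exp (φ x) * conj (v x) * connForm v φ x u)) := by
  have hv := hasWirtingerAt_norm_sq (v.differentiableAt (x := x)) u
  have h := (HasWirtingerAt.const 1 x u).sub (hv.mul (hasWirtingerAt_ofReal hφ u).rexp)
  simp only [ContinuousLinearMap.fderiv, Complex.ofReal_pow] at h
  refine (h.congr_of_eventuallyEq (.of_forall fun y => ?_)).congr_deriv ?_ ?_
  · simp [discDefect]
  all_goals
    simp only [connForm, map_add, map_mul, Complex.conj_ofReal, Complex.conj_conj,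
      ← Complex.mul_conj']
    ring

theorem hasWirtingerAt_inv_discDefect (hφ : DifferentiableAt ℝ φ x) (hpos : 0 < discDefect v φ x)
    (u : E) :
    HasWirtingerAt (fun y => (discDefect v φ y : ℂ)⁻¹) x u
      (logDefectForm v φ x u / discDefect v φ x)
      (conj (logDefectForm v φ x u) / discDefect v φ x) := by
  have hne : (discDefect v φ x : ℂ) ≠ 0 := by exact_mod_cast hpos.ne'
  refine ((hasWirtingerAt_discDefect hφ u).inv hne).congr_deriv ?_ ?_ <;>
  · simp only [logDefectForm, map_div₀, Complex.conj_ofReal]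
    field_simp

theorem hasWirtingerAt_wirtinger_ofReal (hφ : ContDiffAt ℝ 2 φ x) (u c : E) :
    HasWirtingerAt (fun y => wirtinger (fun z => (φ z : ℂ)) y u) x c
      (wirtinger (fun y => wirtinger (fun z => (φ z : ℂ)) y u) x c) (potentialForm φ x u c) :=
  hasWirtingerAt_wirtinger (contDiffAt_ofReal hφ) u c

theorem hasWirtingerAt_connForm (hφ : ContDiffAt ℝ 2 φ x) (u c : E) :
    HasWirtingerAt (fun y => connForm v φ y u) x c
      (v c * wirtinger (fun z => (φ z : ℂ)) x u +
        v x * wirtinger (fun y => wirtinger (fun z => (φ z : ℂ)) y u) x c)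
      (v x * potentialForm φ x u c) :=
  ((HasWirtingerAt.const (v u) x c).add ((HasWirtingerAt.clm v x c).mul
    (hasWirtingerAt_wirtinger_ofReal hφ u c))).congr_deriv (by ring) (by ring)

theorem hasWirtingerAt_discPotential (hφ : DifferentiableAt ℝ φ x) (hpos : 0 < discDefect v φ x)
    (b : E) :
    HasWirtingerAt (fun y => (discPotential v φ y : ℂ)) x b
      (wirtinger (fun z => (φ z : ℂ)) x b + logDefectForm v φ x b)
      (conj (wirtinger (fun z => (φ z : ℂ)) x b + logDefectForm v φ x b)) := by
  have h := (hasWirtingerAt_ofReal hφ b).sub ((hasWirtingerAt_discDefect (v := v) hφ b).log hpos)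
  simp only [← Complex.ofReal_sub] at h
  refine h.congr_deriv ?_ ?_
  · rw [logDefectForm]
    ring
  · rw [logDefectForm, map_add, map_div₀, Complex.conj_ofReal]
    ring

theorem hasWirtingerAt_logDefectForm (hφ : ContDiffAt ℝ 2 φ x) (hpos : 0 < discDefect v φ x)
    (b c : E) :
    HasWirtingerAt (fun y => logDefectForm v φ y b) x c
      (wirtinger (fun y => logDefectForm v φ y b) x c)
      (potentialForm φ x b c * ((discDefect v φ x : ℂ)⁻¹ - 1) +
        Real.exp (φ x) * connForm v φ x b * conj (connForm v φ x c) / discDefect v φ x ^ 2) := by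
  have hφ1 := hφ.differentiableAt two_ne_zero
  have h := (((hasWirtingerAt_ofReal hφ1 c).rexp.mul (HasWirtingerAt.clm v x c).star).mul
    (hasWirtingerAt_connForm (v := v) hφ b c)).mul (hasWirtingerAt_inv_discDefect hφ1 hpos c)
  simp only [← div_eq_mul_inv] at h
  refine ⟨h.differentiableAt, rfl, h.wirtingerBar_eq.trans ?_⟩
  have hne : (discDefect v φ x : ℂ) ≠ 0 := by exact_mod_cast hpos.ne'
  have hdefect : (discDefect v φ x : ℂ) = 1 - v x * conj (v x) * Real.exp (φ x) := by
    simp [discDefect, Complex.mul_conj']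
  simp only [logDefectForm, connForm, map_add, map_mul, map_div₀, Complex.conj_ofReal,
    Complex.conj_conj]
  field_simp
  rw [hdefect]
  ring

theorem potentialForm_discPotential (hφ : ContDiffAt ℝ 2 φ x) (hpos : 0 < discDefect v φ x)
    (u b : E) :
    potentialForm (discPotential v φ) x u b = potentialForm φ x u b / discDefect v φ x +
      Real.exp (φ x) * connForm v φ x u * conj (connForm v φ x b) / discDefect v φ x ^ 2 := by
  have hfirst : (fun y => wirtinger (fun z => (discPotential v φ z : ℂ)) y u) =ᶠ[𝓝 x]
      fun y => wirtinger (fun z => (φ z : ℂ)) y u + logDefectForm v φ y u := by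
    filter_upwards [hφ.eventually (by simp), eventually_discDefect_pos hφ.continuousAt hpos]
      with y hy hypos
    exact (hasWirtingerAt_discPotential (hy.differentiableAt two_ne_zero) hypos u).wirtinger_eq
  rw [potentialForm, ← wirtingerBar_wirtinger
    (contDiffAt_ofReal (contDiffAt_discPotential hφ hpos)), wirtingerBar_congr hfirst,
    ((hasWirtingerAt_wirtinger_ofReal hφ u b).add
      (hasWirtingerAt_logDefectForm hφ hpos u b)).wirtingerBar_eq]
  ring

theorem hasWirtingerAt_exp_mul_conj_connForm (hφ : ContDiffAt ℝ 2 φ x)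
    (hpos : 0 < discDefect v φ x) (b c : E) :
    HasWirtingerAt
      (fun y => Real.exp (φ y) * conj (connForm v φ y b) / (discDefect v φ y : ℂ) ^ 2) x c
      (Real.exp (φ x) / (discDefect v φ x : ℂ) ^ 2 *
        ((wirtinger (fun z => (φ z : ℂ)) x c + 2 * logDefectForm v φ x c) *
          conj (connForm v φ x b) + conj (v x) * potentialForm φ x c b))
      (Real.exp (φ x) / (discDefect v φ x : ℂ) ^ 2 * conj (connDeriv v φ x c b)) := by
  have hφ1 := hφ.differentiableAt two_ne_zero
  have hinv := hasWirtingerAt_inv_discDefect hφ1 hpos c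
  have h := ((hasWirtingerAt_ofReal hφ1 c).rexp.mul
    (hasWirtingerAt_connForm (v := v) hφ b c).star).mul (hinv.mul hinv)
  simp only [← pow_two, inv_pow, ← div_eq_mul_inv] at h
  refine h.congr_deriv ?_ ?_
  · rw [map_mul, conj_potentialForm hφ]
    ring
  · simp only [connDeriv, map_add, map_mul, map_ofNat]
    ring

theorem wirtinger_potentialForm_discPotential (hφ : ContDiffAt ℝ 3 φ x)
    (hpos : 0 < discDefect v φ x) (u b c : E) :
    wirtinger (fun y => potentialForm (discPotential v φ) y u b) x c =
      (wirtinger (fun y => potentialForm φ y u b) x c +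
        logDefectForm v φ x c * potentialForm φ x u b +
        logDefectForm v φ x u * potentialForm φ x c b) / discDefect v φ x +
      Real.exp (φ x) * connDeriv v φ x c u * conj (connForm v φ x b) /
        discDefect v φ x ^ 2 := by
  have hφ2 : ContDiffAt ℝ 2 φ x := hφ.of_le (by norm_num)
  have hmetric : (fun y => potentialForm (discPotential v φ) y u b) =ᶠ[𝓝 x] fun y =>
      potentialForm φ y u b * (discDefect v φ y : ℂ)⁻¹ + connForm v φ y u *
        (Real.exp (φ y) * conj (connForm v φ y b) / (discDefect v φ y : ℂ) ^ 2) := by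
    filter_upwards [hφ2.eventually (by simp), eventually_discDefect_pos hφ.continuousAt hpos]
      with y hy hypos
    rw [potentialForm_discPotential hy hypos]
    ring
  have hprod := ((hasWirtingerAt_potentialForm hφ u b c).mul
    (hasWirtingerAt_inv_discDefect (hφ2.differentiableAt two_ne_zero) hpos c)).add
    ((hasWirtingerAt_connForm (v := v) hφ2 u c).mul
      (hasWirtingerAt_exp_mul_conj_connForm hφ2 hpos b c))
  have hne : (discDefect v φ x : ℂ) ≠ 0 := by exact_mod_cast hpos.ne'
  have hκ : connForm v φ x u * (Real.exp (φ x) * conj (v x)) =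
      logDefectForm v φ x u * discDefect v φ x := by
    rw [logDefectForm]
    field_simp
  rw [wirtinger_congr hmetric, hprod.wirtinger_eq, connDeriv]
  field_simp
  linear_combination potentialForm φ x c b * hκ

theorem hasWirtingerAt_connDeriv_self (hφ : ContDiffAt ℝ 3 φ x) (hpos : 0 < discDefect v φ x)
    (u : E) :
    HasWirtingerAt (fun y => connDeriv v φ y u u) x u
      (wirtinger (fun y => connDeriv v φ y u u) x u)
      (v x * (wirtinger (fun y => potentialForm φ y u u) x u +
          2 * logDefectForm v φ x u * potentialForm φ x u u) +
        2 * connForm v φ x u * potentialForm (discPotential v φ) x u u) := by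
  have hφ2 : ContDiffAt ℝ 2 φ x := hφ.of_le (by norm_num)
  have hfirst := hasWirtingerAt_wirtinger_ofReal hφ2 u u
  have hκ := hasWirtingerAt_logDefectForm hφ2 hpos u u
  have hsecond : HasWirtingerAt
      (fun y => wirtinger (fun y => wirtinger (fun z => (φ z : ℂ)) y u) y u) x u
      (wirtinger (fun y => wirtinger (fun y => wirtinger (fun z => (φ z : ℂ)) y u) y u) x u)
      (wirtinger (fun y => potentialForm φ y u u) x u) := by
    have hdiff := contDiffAt_wirtinger (contDiffAt_ofReal hφ) (m := 2) (by norm_num) u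
    refine (hasWirtingerAt_wirtinger hdiff u u).congr_deriv rfl ?_
    rw [ddbar]
    exact wirtinger_congr ((hφ2.eventually (by simp)).mono fun y hy =>
      wirtingerBar_wirtinger (contDiffAt_ofReal hy) u u) u
  have h := (((HasWirtingerAt.const (v u) x u).mul hfirst).add
    ((HasWirtingerAt.clm v x u).mul hsecond)).add
    ((hfirst.add ((HasWirtingerAt.const 2 x u).mul hκ)).mul
      (hasWirtingerAt_connForm (v := v) hφ2 u u))
  refine ⟨h.differentiableAt, rfl, h.wirtingerBar_eq.trans ?_⟩
  rw [potentialForm_discPotential hφ2 hpos, connForm]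
  ring

theorem ddbar_potentialForm_discPotential_self (hφ : ContDiffAt ℝ 4 φ x)
    (hpos : 0 < discDefect v φ x) (u : E) :
    ddbar (fun y => potentialForm (discPotential v φ) y u u) x u u =
      (ddbar (fun y => potentialForm φ y u u) x u u +
        2 * logDefectForm v φ x u * conj (wirtinger (fun y => potentialForm φ y u u) x u) +
        2 * conj (logDefectForm v φ x u) * wirtinger (fun y => potentialForm φ y u u) x u +
        4 * logDefectForm v φ x u * conj (logDefectForm v φ x u) * potentialForm φ x u u -
        2 * potentialForm φ x u u ^ 2) / discDefect v φ x +
      2 * potentialForm (discPotential v φ) x u u ^ 2 +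
      Real.exp (φ x) * connDeriv v φ x u u * conj (connDeriv v φ x u u) /
        discDefect v φ x ^ 2 := by
  have hφ3 : ContDiffAt ℝ 3 φ x := hφ.of_le (by norm_num)
  have hφ2 : ContDiffAt ℝ 2 φ x := hφ.of_le (by norm_num)
  have hfirst : (fun y => wirtinger (fun y => potentialForm (discPotential v φ) y u u) y u) =ᶠ[𝓝 x]
      fun y => (wirtinger (fun y => potentialForm φ y u u) y u +
          2 * (logDefectForm v φ y u * potentialForm φ y u u)) * (discDefect v φ y : ℂ)⁻¹ +
        connDeriv v φ y u u *
          (Real.exp (φ y) * conj (connForm v φ y u) / (discDefect v φ y : ℂ) ^ 2) := by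
    filter_upwards [hφ3.eventually (by simp), eventually_discDefect_pos hφ.continuousAt hpos]
      with y hy hypos
    rw [wirtinger_potentialForm_discPotential hy hypos]
    ring
  have hg2 : ContDiffAt ℝ 2 (fun y => potentialForm φ y u u) x :=
    contDiffAt_potentialForm hφ (by norm_num) u u
  have h := (((hasWirtingerAt_wirtinger hg2 u u).add ((HasWirtingerAt.const 2 x u).mul
    ((hasWirtingerAt_logDefectForm hφ2 hpos u u).mul (hasWirtingerAt_potentialForm hφ3 u u u)))).mul
      (hasWirtingerAt_inv_discDefect (hφ2.differentiableAt two_ne_zero) hpos u)).add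
    ((hasWirtingerAt_connDeriv_self hφ3 hpos u).mul
      (hasWirtingerAt_exp_mul_conj_connForm hφ2 hpos u u))
  rw [← wirtingerBar_wirtinger (contDiffAt_potentialForm (contDiffAt_discPotential hφ hpos)
    (by norm_num) u u), wirtingerBar_congr hfirst, h.wirtingerBar_eq,
    potentialForm_discPotential hφ2 hpos]
  have hne : (discDefect v φ x : ℂ) ≠ 0 := by exact_mod_cast hpos.ne'
  have hκ : logDefectForm v φ x u * discDefect v φ x =
      Real.exp (φ x) * conj (v x) * connForm v φ x u := div_mul_cancel₀ _ hne
  have hκbar : conj (logDefectForm v φ x u) * discDefect v φ x =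
      Real.exp (φ x) * v x * conj (connForm v φ x u) := by
    simpa only [map_mul, Complex.conj_ofReal, Complex.conj_conj] using congrArg conj hκ
  field_simp
  linear_combination (-(wirtinger (fun y => potentialForm φ y u u) x u +
    2 * logDefectForm v φ x u * potentialForm φ x u u) * discDefect v φ x ^ 2) * hκbar

/-- `g(w, ·) = ∂_u g(u, ·)` is solved for `g_D` by correcting the base solution `w₀` by `2κu` and by
a multiple of the fibre direction `f`, which is `g`-null. -/
theorem curvatureQuartic_discPotential [FiniteDimensional ℂ E] (hφ : ContDiffAt ℝ 4 φ x)
    (hpos : 0 < discDefect v φ x)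
    (hG : IsHermitianInner (potentialForm (discPotential v φ) x)) {u w₀ f : E}
    (hw₀ : ∀ b, wirtinger (fun y => potentialForm φ y u b) x u = potentialForm φ x w₀ b)
    (hθf : connForm v φ x f = 1) (hgf : ∀ b, potentialForm φ x f b = 0) :
    curvatureQuartic (potentialForm (discPotential v φ)) x u =
      (potentialForm φ x w₀ w₀ - ddbar (fun y => potentialForm φ y u u) x u u +
        2 * potentialForm φ x u u ^ 2) / discDefect v φ x -
      2 * potentialForm (discPotential v φ) x u u ^ 2 := by
  have hφ2 : ContDiffAt ℝ 2 φ x := hφ.of_le (by norm_num)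
  let κ := logDefectForm v φ x u
  let w := w₀ + (2 * κ) • u +
    (connDeriv v φ x u u - connForm v φ x w₀ - 2 * κ * connForm v φ x u) • f
  have hθw : connForm v φ x w = connDeriv v φ x u u := by
    simp only [w, connForm_add, connForm_smul, hθf]
    ring
  have hgw (b : E) : potentialForm φ x w b =
      potentialForm φ x w₀ b + 2 * κ * potentialForm φ x u b := by
    simp only [w, potentialForm_add_left, potentialForm_smul_left, hgf, mul_zero, add_zero]
  have hgww : potentialForm φ x w w = potentialForm φ x w₀ w₀ +
      2 * conj κ * potentialForm φ x w₀ u + 2 * κ * conj (potentialForm φ x w₀ u) +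
      4 * κ * conj κ * potentialForm φ x u u := by
    rw [hgw, ← conj_potentialForm hφ2 w w₀, ← conj_potentialForm hφ2 w u, hgw, hgw]
    simp only [map_add, map_mul, map_ofNat, conj_potentialForm hφ2]
    ring
  have hGw (b : E) : wirtinger (fun y => potentialForm (discPotential v φ) y u b) x u =
      potentialForm (discPotential v φ) x w b := by
    rw [wirtinger_potentialForm_discPotential (hφ.of_le (by norm_num)) hpos,
      potentialForm_discPotential hφ2 hpos w, hθw, hgw, hw₀]
    ring
  rw [curvatureQuartic_eq hG hGw, ddbar_potentialForm_discPotential_self hφ hpos,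
    potentialForm_discPotential hφ2 hpos w, hθw, hgww, hw₀]
  ring

end DiscPotential

section HolSectCurvCoord

variable {E : Type*} [NormedAddCommGroup E] [NormedSpace ℂ E] [FiniteDimensional ℂ E]

theorem curvatureQuartic_zero (G : E → E → E → ℂ) (x : E) :
    curvatureQuartic G x 0 = 0 := by
  simp only [curvatureQuartic, wirtinger_zero_right, ddbar, sub_zero]
  exact (congrArg _ (star_zero _)).trans (dotProduct_zero _)

theorem holSectCurvCoord_mul_sq {G : E → E → E → ℂ} {x : E} (hG : IsHermitianInner (G x)) (u : E) :
    holSectCurvCoord G x u * (G x u u).re ^ 2 = (curvatureQuartic G x u).re := by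
  rcases eq_or_ne u 0 with rfl | hu
  · simp [hG.zero_left, curvatureQuartic_zero]
  · exact div_mul_cancel₀ _ (pow_ne_zero 2 (hG.pos u hu).ne')

end HolSectCurvCoord

section DiscModel

variable {E : Type*} [NormedAddCommGroup E] [NormedSpace ℂ E]

section Product

variable {F : Type*} [NormedAddCommGroup F] [NormedSpace ℂ F] {y : E × F}

theorem wirtinger_comp_fst {f : E → ℂ} (hf : DifferentiableAt ℝ f y.1) (u : E × F) :
    wirtinger (fun z : E × F => f z.1) y u = wirtinger f y.1 u.1 := by
  rw [wirtinger_comp (φ := Prod.fst) hf differentiableAt_fst, fderiv_fst,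
    ContinuousLinearMap.coe_fst']

theorem ddbar_comp_fst {f : E → ℂ} (hf : ContDiffAt ℝ 2 f y.1) (u w : E × F) :
    ddbar (fun z : E × F => f z.1) y u w = ddbar f y.1 u.1 w.1 := by
  rw [ddbar_comp (φ := Prod.fst) hf contDiffAt_fst, fderiv_fst, ContinuousLinearMap.coe_fst']

theorem potentialForm_comp_fst {φ : E → ℝ} (hφ : ContDiffAt ℝ 2 φ y.1) (u w : E × F) :
    potentialForm (fun z : E × F => φ z.1) y u w = potentialForm φ y.1 u.1 w.1 :=
  ddbar_comp_fst (contDiffAt_ofReal hφ) u w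

theorem potentialForm_comp_fst_eventuallyEq {φ : E → ℝ} (hφ : ContDiffAt ℝ 2 φ y.1) (u w : E × F) :
    (fun z => potentialForm (fun z : E × F => φ z.1) z u w) =ᶠ[𝓝 y]
      fun z => potentialForm φ z.1 u.1 w.1 := by
  filter_upwards [continuousAt_fst.eventually (hφ.eventually (by simp))] with z hz
  exact potentialForm_comp_fst hz u w

end Product

/-- The linear coordinate on the fibre of the model `E × Hom(ℂ, ℂ)` of the dual line bundle. -/
noncomputable def fiberCoord (E : Type*) [NormedAddCommGroup E] [NormedSpace ℂ E] :
    E × (ℂ →L[ℂ] ℂ) →L[ℂ] ℂ :=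
  (ContinuousLinearMap.apply ℂ ℂ (1 : ℂ)).comp (ContinuousLinearMap.snd ℂ E (ℂ →L[ℂ] ℂ))

theorem fiberCoord_apply (y : E × (ℂ →L[ℂ] ℂ)) : fiberCoord E y = y.2 1 := rfl

variable {φ : E → ℝ} {y : E × (ℂ →L[ℂ] ℂ)}

theorem connForm_fiberCoord_of_fst_eq_zero {u : E × (ℂ →L[ℂ] ℂ)} (hφ : DifferentiableAt ℝ φ y.1)
    (hu : u.1 = 0) : connForm (fiberCoord E) (fun z => φ z.1) y u = u.2 1 := by
  rw [connForm, wirtinger_comp_fst (f := fun z => (φ z : ℂ))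
    (Complex.ofRealCLM.differentiableAt.comp y.1 hφ), hu, wirtinger_zero_right, mul_zero, add_zero,
    fiberCoord_apply]

theorem isHermitianInner_potentialForm_discPotential (hφ : ContDiffAt ℝ 2 φ y.1)
    (hg : IsHermitianInner (potentialForm φ y.1))
    (hpos : 0 < discDefect (fiberCoord E) (fun z => φ z.1) y) :
    IsHermitianInner (potentialForm (discPotential (fiberCoord E) (fun z => φ z.1)) y) := by
  have hΦ : ContDiffAt ℝ 2 (fun z : E × (ℂ →L[ℂ] ℂ) => φ z.1) y := hφ.comp y contDiffAt_fst
  refine ⟨potentialForm_add_left _ _, potentialForm_smul_left _ _,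
    fun u w => (conj_potentialForm (contDiffAt_discPotential hΦ hpos) u w).symm, fun u hu => ?_⟩
  rw [potentialForm_discPotential hΦ hpos, potentialForm_comp_fst hφ, mul_assoc, Complex.mul_conj,
    ← hg.ofReal_re_self]
  norm_cast
  rcases eq_or_ne u.1 0 with h0 | h0
  · have hθ : connForm (fiberCoord E) (fun z => φ z.1) y u ≠ 0 := by
      rw [connForm_fiberCoord_of_fst_eq_zero (hφ.differentiableAt two_ne_zero) h0]
      exact fun h2 => hu (Prod.ext h0 (ContinuousLinearMap.ext_ring h2))
    have hnonneg := hg.re_apply_self_nonneg u.1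
    have hsq := Complex.normSq_pos.2 hθ
    positivity
  · have hbase := hg.pos u.1 h0
    have hsq := Complex.normSq_nonneg (connForm (fiberCoord E) (fun z => φ z.1) y u)
    positivity

variable [FiniteDimensional ℂ E]

theorem curvatureQuartic_discPotential_fiberCoord (hφ : ContDiffAt ℝ 4 φ y.1)
    (hg : IsHermitianInner (potentialForm φ y.1))
    (hpos : 0 < discDefect (fiberCoord E) (fun z => φ z.1) y) (u : E × (ℂ →L[ℂ] ℂ)) :
    curvatureQuartic (potentialForm (discPotential (fiberCoord E) (fun z => φ z.1))) y u =
      (curvatureQuartic (potentialForm φ) y.1 u.1 + 2 * potentialForm φ y.1 u.1 u.1 ^ 2) /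
        discDefect (fiberCoord E) (fun z => φ z.1) y -
      2 * potentialForm (discPotential (fiberCoord E) (fun z => φ z.1)) y u u ^ 2 := by
  have hφ2 : ContDiffAt ℝ 2 φ y.1 := hφ.of_le (by norm_num)
  have hΦ : ContDiffAt ℝ 4 (fun z : E × (ℂ →L[ℂ] ℂ) => φ z.1) y := hφ.comp y contDiffAt_fst
  have hcoeff (a b : E) : ContDiffAt ℝ 2 (fun z => potentialForm φ z a b) y.1 :=
    contDiffAt_potentialForm hφ (by norm_num) a b
  obtain ⟨B, -, hB⟩ := exists_christoffel (hφ.of_le (by norm_num)) hg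
  have hw₀ (b : E × (ℂ →L[ℂ] ℂ)) :
      wirtinger (fun z => potentialForm (fun z : E × (ℂ →L[ℂ] ℂ) => φ z.1) z u b) y u =
        potentialForm (fun z : E × (ℂ →L[ℂ] ℂ) => φ z.1) y (B u.1 u.1, 0) b := by
    rw [wirtinger_congr (potentialForm_comp_fst_eventuallyEq hφ2 u b), wirtinger_comp_fst
      (f := fun z => potentialForm φ z u.1 b.1) ((hcoeff _ _).differentiableAt two_ne_zero),
      potentialForm_comp_fst hφ2, hB]
  have hθ : connForm (fiberCoord E) (fun z => φ z.1) y (0, ContinuousLinearMap.id ℂ ℂ) = 1 :=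
    connForm_fiberCoord_of_fst_eq_zero (hφ2.differentiableAt two_ne_zero) rfl
  rw [curvatureQuartic_discPotential hΦ hpos
    (isHermitianInner_potentialForm_discPotential hφ2 hg hpos) hw₀ hθ
    (fun b => by rw [potentialForm_comp_fst hφ2, hg.zero_left]),
    ddbar_congr (potentialForm_comp_fst_eventuallyEq hφ2 u u),
    ddbar_comp_fst (f := fun z => potentialForm φ z u.1 u.1) (hcoeff _ _),
    potentialForm_comp_fst hφ2, potentialForm_comp_fst hφ2,
    curvatureQuartic_eq hg fun b => (hB u.1 u.1 b).symm]

theorem holSectCurvCoord_discPotential_fiberCoord (hφ : ContDiffAt ℝ 4 φ y.1)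
    (hg : IsHermitianInner (potentialForm φ y.1))
    (hpos : 0 < discDefect (fiberCoord E) (fun z => φ z.1) y) (u : E × (ℂ →L[ℂ] ℂ)) :
    holSectCurvCoord (potentialForm (discPotential (fiberCoord E) (fun z => φ z.1))) y u =
      -2 * ((potentialForm (discPotential (fiberCoord E) (fun z => φ z.1)) y u u).re ^ 2 -
        (potentialForm φ y.1 u.1 u.1).re ^ 2 / discDefect (fiberCoord E) (fun z => φ z.1) y *
          (1 + 1 / 2 * holSectCurvCoord (potentialForm φ) y.1 u.1)) /
      (potentialForm (discPotential (fiberCoord E) (fun z => φ z.1)) y u u).re ^ 2 := by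
  have hG := isHermitianInner_potentialForm_discPotential (hφ.of_le (by norm_num)) hg hpos
  have hre : (curvatureQuartic
      (potentialForm (discPotential (fiberCoord E) (fun z => φ z.1))) y u).re =
      ((curvatureQuartic (potentialForm φ) y.1 u.1).re + 2 * (potentialForm φ y.1 u.1 u.1).re ^ 2) /
        discDefect (fiberCoord E) (fun z => φ z.1) y -
      2 * (potentialForm (discPotential (fiberCoord E) (fun z => φ z.1)) y u u).re ^ 2 := by
    rw [curvatureQuartic_discPotential_fiberCoord hφ hg hpos, ← hg.ofReal_re_self u.1,
      ← hG.ofReal_re_self u, Complex.sub_re, Complex.div_ofReal_re, Complex.add_re]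
    norm_cast
  rw [holSectCurvCoord, hre, ← holSectCurvCoord_mul_sq hg]
  ring

end DiscModel

section ManifoldForms

variable {E : Type*} [NormedAddCommGroup E] [NormedSpace ℂ E]
  {H : Type*} [TopologicalSpace H] {I : ModelWithCorners ℂ E H}
  {N : Type*} [TopologicalSpace N] [ChartedSpace H N]
  {E' : Type*} [NormedAddCommGroup E'] [NormedSpace ℂ E']

/-- The closedness condition holds because mixed partial derivatives of the potentials commute. -/
theorem isKahlerOn_of_potential {g : FormField I N} {S : Set N}
    (hg : ∀ p ∈ S, IsHermitianInner (V := TangentSpace I p) (g p))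
    (K : N → E → ℝ) (hK : ∀ p ∈ S, ContDiffAt ℝ ∞ (K p) (extChartAt I p p))
    (hgK : ∀ p ∈ S, coeffs I g (extChartAt I p).symm =ᶠ[𝓝 (extChartAt I p p)]
      potentialForm (K p)) :
    IsKahlerOn I g S := by
  have entry : ∀ p ∈ S, ∀ a b, (fun z => coeffs I g (extChartAt I p).symm z a b)
      =ᶠ[𝓝 (extChartAt I p p)] fun z => potentialForm (K p) z a b :=
    fun p hp a b => (hgK p hp).mono fun z hz => by simp only [hz]
  refine ⟨hg, fun p hp a b => ?_, fun p hp a b c => ?_⟩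
  · exact (contDiffAt_potentialForm (hK p hp) (by norm_cast) a b).congr_of_eventuallyEq
      (entry p hp a b)
  · rw [wirtinger_congr (entry p hp a b), wirtinger_congr (entry p hp c b)]
    exact wirtinger_potentialForm_comm ((hK p hp).of_le (by norm_cast)) a b c

theorem mfderiv_eq_fderiv_extChartAt_comp {ψ : E' → N} {y : E'}
    (hψ : MDifferentiableAt 𝓘(ℂ, E') I ψ y) :
    (mfderiv 𝓘(ℂ, E') I ψ y : E' →L[ℂ] E) = fderiv ℂ (fun z => extChartAt I (ψ y) (ψ z)) y := by
  rw [hψ.mfderiv]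
  simp only [mfld_simps, fderivWithin_univ]
  rfl

theorem contDiffAt_extChartAt_comp {n : WithTop ℕ∞} {ψ : E' → N} {y : E'}
    (hψ : ContMDiffAt 𝓘(ℂ, E') I n ψ y) :
    ContDiffAt ℂ n (fun z => extChartAt I (ψ y) (ψ z)) y :=
  (contMDiffAt_iff_target.1 hψ).2.contDiffAt

theorem coeffs_leviForm {f : N → ℝ} {ψ : E' → N} {y : E'}
    (hψ : ContMDiffAt 𝓘(ℂ, E') I 2 ψ y)
    (hf : ContDiffAt ℝ 2 (f ∘ (extChartAt I (ψ y)).symm) (extChartAt I (ψ y) (ψ y))) (a b : E') :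
    coeffs I (leviForm I f) ψ y a b = potentialForm (f ∘ ψ) y a b := by
  have in_chart : f ∘ ψ =ᶠ[𝓝 y]
      fun z => (f ∘ (extChartAt I (ψ y)).symm) (extChartAt I (ψ y) (ψ z)) := by
    filter_upwards [hψ.continuousAt.eventually (extChartAt_source_mem_nhds (I := I) (ψ y))]
      with z hz
    simp only [Function.comp_apply]
    rw [(extChartAt I (ψ y)).left_inv hz]
  rw [potentialForm_congr in_chart,
    potentialForm_comp (ψ := fun z => extChartAt I (ψ y) (ψ z)) hf (contDiffAt_extChartAt_comp hψ),
    ← mfderiv_eq_fderiv_extChartAt_comp (hψ.mdifferentiableAt (by norm_num))]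
  rfl

variable [I.Boundaryless] [IsManifold I ω N]

theorem contMDiffAt_extChartAt_symm {p : N} {y : E} (hy : y ∈ (extChartAt I p).target) :
    ContMDiffAt 𝓘(ℂ, E) I ω (extChartAt I p).symm y :=
  (contMDiffOn_extChartAt_symm p).contMDiffAt ((isOpen_extChartAt_target p).mem_nhds hy)

theorem mfderiv_extChartAt_symm_self (p : N) :
    (mfderiv 𝓘(ℂ, E) I (extChartAt I p).symm (extChartAt I p p) : E →L[ℂ] E) = .id ℂ E := by
  have right_inv : (fun z => extChartAt I p ((extChartAt I p).symm z))
      =ᶠ[𝓝 (extChartAt I p p)] id := by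
    filter_upwards [extChartAt_target_mem_nhds (I := I) p] with z hz
    exact (extChartAt I p).right_inv hz
  rw [mfderiv_eq_fderiv_extChartAt_comp ((contMDiffAt_extChartAt_symm
    (mem_extChartAt_target p)).mdifferentiableAt (by norm_num)), extChartAt_to_inv,
    right_inv.fderiv_eq, fderiv_id]

theorem coeffs_extChartAt_symm_self (g : FormField I N) (p : N) :
    coeffs I g (extChartAt I p).symm (extChartAt I p p) = (g p : E → E → ℂ) := by
  have coeffs_eq : ∀ q,
      (mfderiv 𝓘(ℂ, E) I (extChartAt I p).symm (extChartAt I p p) : E →L[ℂ] E) = .id ℂ E →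
      (extChartAt I p).symm (extChartAt I p p) = q →
      coeffs I g (extChartAt I p).symm (extChartAt I p p) = (g q : E → E → ℂ) := by
    rintro q hD rfl
    funext a b
    exact congrArg₂ (g _) (congrArg (fun T : E →L[ℂ] E => T a) hD)
      (congrArg (fun T : E →L[ℂ] E => T b) hD)
  exact coeffs_eq p (mfderiv_extChartAt_symm_self p) (extChartAt_to_inv p)

end ManifoldForms

section Frames

variable {E : Type*} [NormedAddCommGroup E] [NormedSpace ℂ E]
  {H : Type*} [TopologicalSpace H] {I : ModelWithCorners ℂ E H}
  {M : Type*} [TopologicalSpace M] [ChartedSpace H M]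
  {L : M → Type*} [∀ x, AddCommGroup (L x)] [∀ x, Module ℂ (L x)] [∀ x, TopologicalSpace (L x)]
  [TopologicalSpace (TotalSpace ℂ L)] [FiberBundle ℂ L]

/-- The section `s` of `L` is a holomorphic frame near `x`. -/
structure IsHolomorphicFrameAt (I : ModelWithCorners ℂ E H) (s : ∀ x, L x) (x : M) : Prop where
  contMDiffAt : ContMDiffAt I (I.prod 𝓘(ℂ, ℂ)) ω (fun y => TotalSpace.mk' ℂ y (s y)) x
  ne_zero : s x ≠ 0

section LocalFrame

variable [VectorBundle ℂ ℂ L] {p x : M}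

theorem smul_localFrame (hx : x ∈ (trivializationAt ℂ L p).baseSet) (s : L x) :
    (trivializationAt ℂ L p ⟨x, s⟩).2 • localFrame L p x = s := by
  set c := (trivializationAt ℂ L p ⟨x, s⟩).2 with hc
  have symm_linear := map_smul ((trivializationAt ℂ L p).symmₗ ℂ x) c 1
  simp only [Trivialization.symmₗ_apply _ hx, smul_eq_mul, mul_one] at symm_linear
  rw [localFrame, ← symm_linear, hc]
  exact (trivializationAt ℂ L p).symm_apply_apply_mk hx s

theorem localFrame_ne_zero (hx : x ∈ (trivializationAt ℂ L p).baseSet) :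
    localFrame L p x ≠ 0 := fun h => by
  have coord_one := (trivializationAt ℂ L p).apply_mk_symm hx (1 : ℂ)
  rw [← localFrame, h] at coord_one
  exact zero_ne_one (congrArg Prod.snd
    (((trivializationAt ℂ L p).zeroSection ℂ hx).symm.trans coord_one))

variable [ContMDiffVectorBundle ω ℂ L I]

theorem contMDiffOn_localFrame (p : M) :
    ContMDiffOn I (I.prod 𝓘(ℂ, ℂ)) ω (fun x => TotalSpace.mk' ℂ x (localFrame L p x))
      (trivializationAt ℂ L p).baseSet := by
  rw [Trivialization.contMDiffOn_section_baseSet_iff (trivializationAt ℂ L p)]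
  refine (contMDiffOn_const (c := (1 : ℂ))).congr fun x hx => ?_
  rw [localFrame, Trivialization.apply_mk_symm _ hx]

theorem isHolomorphicFrameAt_localFrame (hx : x ∈ (trivializationAt ℂ L p).baseSet) :
    IsHolomorphicFrameAt I (localFrame L p) x :=
  ⟨(contMDiffOn_localFrame p).contMDiffAt ((trivializationAt ℂ L p).open_baseSet.mem_nhds hx),
    localFrame_ne_zero hx⟩

theorem IsHolomorphicFrameAt.exists_eq_smul_localFrame {s : ∀ x, L x}
    (hs : IsHolomorphicFrameAt I s x) (hx : x ∈ (trivializationAt ℂ L p).baseSet) :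
    ∃ c : M → ℂ, ContMDiffAt I 𝓘(ℂ, ℂ) ω c x ∧ c x ≠ 0 ∧
      ∀ y ∈ (trivializationAt ℂ L p).baseSet, s y = c y • localFrame L p y := by
  refine ⟨fun y => (trivializationAt ℂ L p ⟨y, s y⟩).2,
    ((trivializationAt ℂ L p).contMDiffAt_section_iff hx).1 hs.contMDiffAt, fun hc => ?_,
    fun y hy => (smul_localFrame hy (s y)).symm⟩
  have coord_zero : (trivializationAt ℂ L p ⟨x, s x⟩).2 = 0 := hc
  exact hs.ne_zero (by rw [← smul_localFrame hx (s x), coord_zero, zero_smul])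

theorem IsHolomorphicFrameAt.eventually_ne_zero {s : ∀ x, L x} (hs : IsHolomorphicFrameAt I s x) :
    ∀ᶠ y in 𝓝 x, s y ≠ 0 := by
  have base_mem := FiberBundle.mem_baseSet_trivializationAt' (F := ℂ) (E := L) x
  obtain ⟨c, hc, hc0, s_eq⟩ := hs.exists_eq_smul_localFrame base_mem
  filter_upwards [hc.continuousAt.eventually_ne hc0,
    (trivializationAt ℂ L x).open_baseSet.mem_nhds base_mem] with y hcy hy
  rw [s_eq y hy]
  exact smul_ne_zero hcy (localFrame_ne_zero hy)

theorem contMDiffOn_smul_localFrame {c : M → ℂ} {S : Set M} (hc : ContMDiffOn I 𝓘(ℂ, ℂ) ω c S)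
    (hS : S ⊆ (trivializationAt ℂ L p).baseSet) :
    ContMDiffOn I (I.prod 𝓘(ℂ, ℂ)) ω
      (fun x => TotalSpace.mk' ℂ x (c x • localFrame L p x)) S :=
  hc.smul_section ((contMDiffOn_localFrame p).mono hS)

end LocalFrame

namespace HermitianLineMetric

variable (h : HermitianLineMetric I L) {p x : M}

theorem normSq_smul (c : ℂ) (s : L x) : h.normSq (c • s) = ‖c‖ ^ 2 * h.normSq s := by
  unfold normSq
  rw [(h.hermitian x).smul_left, (h.hermitian x).smul_right, ← mul_assoc, Complex.mul_conj,
    Complex.re_ofReal_mul, Complex.normSq_eq_norm_sq]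

theorem normSq_pos {s : L x} (hs : s ≠ 0) : 0 < h.normSq s := (h.hermitian x).pos s hs

theorem ne_zero_of_normSq_eq_one {s : L x} (hs : h.normSq s = 1) : s ≠ 0 := by
  rintro rfl
  rw [← zero_smul ℂ (0 : L x), normSq_smul] at hs
  simp at hs

/-- The Kähler potential `-log |s|²_h` of the curvature form given by the section `s`. -/
noncomputable def potential (s : ∀ x, L x) (x : M) : ℝ := -Real.log (h.normSq (s x))

/-- The potential of the preferred frame at `p`, in the preferred chart at `p`. -/
noncomputable def localPotential (p : M) (z : E) : ℝ :=
  h.potential (localFrame L p) ((extChartAt I p).symm z)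

theorem curvatureForm_eq_potentialForm (p : M) (U V : TangentSpace I p) :
    h.curvatureForm p U V = potentialForm (h.localPotential p) (extChartAt I p p) U V :=
  (potentialForm_neg _ _ _ _).symm

theorem isHermitianInner_potentialForm_localPotential {p : M}
    (hp : IsHermitianInner (V := TangentSpace I p) (h.curvatureForm p)) :
    IsHermitianInner (potentialForm (h.localPotential p) (extChartAt I p p)) := by
  rwa [← funext₂ (h.curvatureForm_eq_potentialForm p)]

theorem exp_potential {s : ∀ x, L x} (hs : s x ≠ 0) :
    Real.exp (h.potential s x) = (h.normSq (s x))⁻¹ := by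
  rw [potential, Real.exp_neg, Real.exp_log (h.normSq_pos hs)]

theorem potential_smul {c : M → ℂ} {s : ∀ x, L x} (hc : c x ≠ 0) (hs : s x ≠ 0) :
    h.potential (fun y => c y • s y) x = h.potential s x - Real.log (‖c x‖ ^ 2) := by
  have := (h.normSq_pos hs).ne'
  rw [potential, normSq_smul, Real.log_mul (by positivity) this, potential]
  ring

theorem potential_localFrame_comp_eventuallyEq {X : Type*} [TopologicalSpace X] {ψ : X → M}
    {y : X} (hψ : ContinuousAt ψ y) :
    (fun z => h.potential (localFrame L (ψ y)) (ψ z)) =ᶠ[𝓝 y]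
      fun z => h.localPotential (ψ y) (extChartAt I (ψ y) (ψ z)) := by
  filter_upwards [hψ.eventually (extChartAt_source_mem_nhds (I := I) (ψ y))] with z hz
  rw [localPotential, (extChartAt I (ψ y)).left_inv hz]

variable [VectorBundle ℂ ℂ L]

theorem dualNormSq_eq (η : DualTotal L) {s : ∀ x, L x} (hs : s η.1 ≠ 0) :
    h.dualNormSq η = ‖(η.2 (s η.1) : ℂ)‖ ^ 2 * Real.exp (h.potential s η.1) := by
  have base_mem := FiberBundle.mem_baseSet_trivializationAt' (F := ℂ) (E := L) η.1
  set c := (trivializationAt ℂ L η.1 ⟨η.1, s η.1⟩).2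
  have s_eq : c • localFrame L η.1 η.1 = s η.1 := smul_localFrame base_mem _
  have c_ne : ‖c‖ ≠ 0 := fun hc => hs (by rw [← s_eq, norm_eq_zero.1 hc, zero_smul])
  rw [h.exp_potential hs, ← s_eq, normSq_smul, map_smul, smul_eq_mul, norm_mul, mul_pow,
    ← div_eq_mul_inv, mul_div_mul_left _ _ (pow_ne_zero 2 c_ne), dualNormSq]

theorem contDiffAt_localPotential (p : M) :
    ContDiffAt ℝ ∞ (h.localPotential p) (extChartAt I p p) := by
  refine (ContDiffAt.log (h.smooth p) ?_).neg
  rw [Function.comp_apply, extChartAt_to_inv]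
  exact (h.normSq_pos (localFrame_ne_zero (FiberBundle.mem_baseSet_trivializationAt' p))).ne'

section ChangeOfFrame

variable {E' : Type*} [NormedAddCommGroup E'] [NormedSpace ℂ E'] {ψ : E' → M} {y : E'}
  {s : ∀ x, L x}

theorem contDiffAt_localPotential_comp (hψ : ContMDiffAt 𝓘(ℂ, E') I ω ψ y) :
    ContDiffAt ℝ ∞ (fun z => h.localPotential (ψ y) (extChartAt I (ψ y) (ψ z))) y :=
  ContDiffAt.comp y (f := fun z => extChartAt I (ψ y) (ψ z)) (h.contDiffAt_localPotential (ψ y))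
    (((contDiffAt_extChartAt_comp hψ).restrict_scalars ℝ).of_le le_top)

variable [ContMDiffVectorBundle ω ℂ L I]

theorem exists_potential_comp_eventuallyEq (hψ : ContMDiffAt 𝓘(ℂ, E') I ω ψ y)
    (hs : IsHolomorphicFrameAt I s (ψ y)) :
    ∃ c : E' → ℂ, ContDiffAt ℂ ω c y ∧ c y ≠ 0 ∧ (fun z => h.potential s (ψ z)) =ᶠ[𝓝 y]
      fun z => h.localPotential (ψ y) (extChartAt I (ψ y) (ψ z)) - Real.log (‖c z‖ ^ 2) := by
  have base_mem := FiberBundle.mem_baseSet_trivializationAt' (F := ℂ) (E := L) (ψ y)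
  obtain ⟨c, hc, hc0, s_eq⟩ := hs.exists_eq_smul_localFrame base_mem
  have hcψ : ContDiffAt ℂ ω (c ∘ ψ) y := (hc.comp y hψ).contDiffAt
  refine ⟨c ∘ ψ, hcψ, hc0, ?_⟩
  filter_upwards [hψ.continuousAt.eventually
    ((trivializationAt ℂ L (ψ y)).open_baseSet.mem_nhds base_mem),
    hcψ.continuousAt.eventually_ne hc0,
    h.potential_localFrame_comp_eventuallyEq hψ.continuousAt] with z hz hcz local_eq
  rw [← local_eq, Function.comp_apply, ← h.potential_smul hcz (localFrame_ne_zero hz), potential,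
    potential, s_eq _ hz]

theorem contDiffAt_potential_comp (hψ : ContMDiffAt 𝓘(ℂ, E') I ω ψ y)
    (hs : IsHolomorphicFrameAt I s (ψ y)) :
    ContDiffAt ℝ ∞ (fun z => h.potential s (ψ z)) y := by
  obtain ⟨c, hc, hc0, potential_eq⟩ := h.exists_potential_comp_eventuallyEq hψ hs
  exact ((h.contDiffAt_localPotential_comp hψ).sub
    (contDiffAt_log_norm_sq (hc.of_le le_top) hc0)).congr_of_eventuallyEq potential_eq

/-- Two frames differ by a holomorphic factor, whose `log |·|²` is annihilated by `∂∂̄`. -/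
theorem coeffs_curvatureForm (hψ : ContMDiffAt 𝓘(ℂ, E') I ω ψ y)
    (hs : IsHolomorphicFrameAt I s (ψ y)) :
    coeffs I h.curvatureForm ψ y = potentialForm (fun z => h.potential s (ψ z)) y := by
  obtain ⟨c, hc, hc0, potential_eq⟩ := h.exists_potential_comp_eventuallyEq hψ hs
  ext a b
  have hchart : ContDiffAt ℂ 2 (fun z => extChartAt I (ψ y) (ψ z)) y :=
    (contDiffAt_extChartAt_comp hψ).of_le le_top
  rw [potentialForm_congr potential_eq, potentialForm_sub
      ((h.contDiffAt_localPotential_comp hψ).of_le (by norm_cast))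
      (contDiffAt_log_norm_sq (hc.of_le le_top) hc0),
    potentialForm_log_norm_sq (hc.of_le le_top) hc0, sub_zero,
    potentialForm_comp (ψ := fun z => extChartAt I (ψ y) (ψ z))
      ((h.contDiffAt_localPotential (ψ y)).of_le (by norm_cast)) hchart,
    ← mfderiv_eq_fderiv_extChartAt_comp (hψ.mdifferentiableAt (by simp))]
  exact h.curvatureForm_eq_potentialForm _ _ _

end ChangeOfFrame

end HermitianLineMetric

end Frames

section DualBundle

variable {E : Type*} [NormedAddCommGroup E] [NormedSpace ℂ E]
  {H : Type*} [TopologicalSpace H] {I : ModelWithCorners ℂ E H}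
  {M : Type*} [TopologicalSpace M] [ChartedSpace H M]
  {L : M → Type*} [∀ x, AddCommGroup (L x)] [∀ x, Module ℂ (L x)] [∀ x, TopologicalSpace (L x)]
  [TopologicalSpace (TotalSpace ℂ L)] [FiberBundle ℂ L] [VectorBundle ℂ ℂ L]

section Charts

theorem extChartAt_dual_fst (η ξ : DualTotal L) :
    (extChartAt (dualModel I) η ξ).1 = extChartAt I η.1 ξ.1 := by
  rw [FiberBundle.extChartAt]
  rfl

theorem mem_extChartAt_dual_target {η : DualTotal L} {w : E × (ℂ →L[ℂ] ℂ)} :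
    w ∈ (extChartAt (dualModel I) η).target ↔ w.1 ∈ (extChartAt I η.1).target ∧
      (extChartAt I η.1).symm w.1 ∈ (trivializationAt ℂ L η.1).baseSet := by
  rw [FiberBundle.extChartAt_target]
  simp

variable {η : DualTotal L} {w : E × (ℂ →L[ℂ] ℂ)}

theorem extChartAt_dual_symm_fst (hw : w ∈ (extChartAt (dualModel I) η).target) :
    ((extChartAt (dualModel I) η).symm w).1 = (extChartAt I η.1).symm w.1 := by
  refine FiberBundle.chartedSpace_chartAt_symm_fst η _ ?_
  simp only [extChartAt, mfld_simps] at hw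
  exact hw.2

theorem fiberCoord_extChartAt {ξ : DualTotal L}
    (hξ : ξ.1 ∈ (trivializationAt ℂ L η.1).baseSet) :
    fiberCoord E (extChartAt (dualModel I) η ξ) = (ξ.2 (localFrame L η.1 ξ.1) : ℂ) := by
  rw [FiberBundle.extChartAt, fiberCoord_apply]
  change (ContinuousLinearMap.inCoordinates ℂ L ℂ (Bundle.Trivial M ℂ) η.1 ξ.1 η.1 ξ.1 ξ.2) 1 = _
  change ((trivializationAt ℂ (Bundle.Trivial M ℂ) η.1).continuousLinearMapAt ℂ ξ.1)
    (ξ.2 ((trivializationAt ℂ L η.1).symmL ℂ ξ.1 1)) = _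
  rw [Trivialization.symmL_apply _ hξ]
  exact congrArg (fun T : ℂ →L[ℂ] ℂ => T (ξ.2 (localFrame L η.1 ξ.1)))
    (Bundle.Trivial.continuousLinearMapAt_trivialization ℂ M ℂ ξ.1)

theorem extChartAt_dual_symm_apply_localFrame (hw : w ∈ (extChartAt (dualModel I) η).target) :
    (((extChartAt (dualModel I) η).symm w).2
      (localFrame L η.1 ((extChartAt (dualModel I) η).symm w).1) : ℂ) = fiberCoord E w := by
  rw [← fiberCoord_extChartAt (E := E) (I := I), (extChartAt (dualModel I) η).right_inv hw]
  rw [extChartAt_dual_symm_fst hw]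
  exact (mem_extChartAt_dual_target.1 hw).2

end Charts

section Projection

variable {F : Type*} [NormedAddCommGroup F] [NormedSpace ℂ F] {Ψ : F → DualTotal L} {y : F}

theorem contMDiffAt_fst_comp (hΨ : ContMDiffAt 𝓘(ℂ, F) (dualModel I) ω Ψ y) :
    ContMDiffAt 𝓘(ℂ, F) I ω (fun z => (Ψ z).1) y :=
  (contMDiffAt_proj (fun x => L x →L[ℂ] Bundle.Trivial M ℂ x)).comp y hΨ

theorem coeffs_fst_comp (g : FormField I M) (hΨ : ContMDiffAt 𝓘(ℂ, F) (dualModel I) ω Ψ y)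
    (a b : F) :
    coeffs I g (fun z => (Ψ z).1) y a b =
      g (Ψ y).1 (dualProjDeriv (Ψ y) (mfderiv 𝓘(ℂ, F) (dualModel I) Ψ y a))
        (dualProjDeriv (Ψ y) (mfderiv 𝓘(ℂ, F) (dualModel I) Ψ y b)) := by
  have proj : ContMDiffAt (dualModel I) I ω (TotalSpace.proj : DualTotal L → M) (Ψ y) :=
    contMDiffAt_proj (fun x => L x →L[ℂ] Bundle.Trivial M ℂ x)
  have chain_rule : mfderiv 𝓘(ℂ, F) I (fun z => (Ψ z).1) y = _ :=
    mfderiv_comp (I' := dualModel I) y (proj.mdifferentiableAt (by simp))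
      (hΨ.mdifferentiableAt (by simp))
  rw [coeffs, chain_rule]
  rfl

end Projection

theorem dualProjDeriv_eq_fst [I.Boundaryless] (η : DualTotal L) (U : E × (ℂ →L[ℂ] ℂ)) :
    dualProjDeriv (I := I) η U = U.1 := by
  have mdiff : MDifferentiableAt (dualModel I) I (TotalSpace.proj : DualTotal L → M) η :=
    (contMDiffAt_proj (n := 1) (fun x => L x →L[ℂ] Bundle.Trivial M ℂ x)).mdifferentiableAt
      one_ne_zero
  have proj_in_charts : writtenInExtChartAt (dualModel I) I η (TotalSpace.proj : DualTotal L → M)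
      =ᶠ[𝓝 (extChartAt (dualModel I) η η)] Prod.fst := by
    filter_upwards [extChartAt_target_mem_nhds (I := dualModel I) η] with w hw
    simp only [writtenInExtChartAt, Function.comp_apply]
    rw [extChartAt_dual_symm_fst hw]
    exact (extChartAt I η.1).right_inv (mem_extChartAt_dual_target.1 hw).1
  change mfderiv (dualModel I) I (TotalSpace.proj : DualTotal L → M) η U = U.1
  rw [mdiff.mfderiv, ModelWithCorners.range_eq_univ, fderivWithin_univ,
    proj_in_charts.fderiv_eq, fderiv_fst]
  rfl

namespace HermitianLineMetric

variable (h : HermitianLineMetric I L)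

theorem one_sub_dualNormSq_eq_discDefect {F : Type*} [NormedAddCommGroup F] [NormedSpace ℂ F]
    {Ψ : F → DualTotal L} {v : F →L[ℂ] ℂ} {s : ∀ x, L x} {z : F} (hs : s (Ψ z).1 ≠ 0)
    (hv : ((Ψ z).2 (s (Ψ z).1) : ℂ) = v z) :
    1 - h.dualNormSq (Ψ z) = discDefect v (fun z => h.potential s (Ψ z).1) z := by
  rw [h.dualNormSq_eq _ hs, hv, discDefect]

variable {h} {η : DualTotal L}

/-- The potential of `g_D` in the preferred chart of `L*` at `η`. -/
noncomputable def localDiscPotential (h : HermitianLineMetric I L) (η : DualTotal L) :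
    E × (ℂ →L[ℂ] ℂ) → ℝ :=
  discPotential (fiberCoord E) fun z => h.localPotential η.1 z.1

theorem one_sub_dualNormSq_extChartAt_symm {w : E × (ℂ →L[ℂ] ℂ)}
    (hw : w ∈ (extChartAt (dualModel I) η).target) :
    1 - h.dualNormSq ((extChartAt (dualModel I) η).symm w) =
      discDefect (fiberCoord E) (fun z => h.localPotential η.1 z.1) w := by
  have fst_eq := extChartAt_dual_symm_fst hw
  have base_mem := (mem_extChartAt_dual_target.1 hw).2
  rw [h.one_sub_dualNormSq_eq_discDefect (localFrame_ne_zero (fst_eq ▸ base_mem))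
    (extChartAt_dual_symm_apply_localFrame hw), discDefect, discDefect, fst_eq, localPotential]

theorem discDefect_extChartAt_self :
    discDefect (fiberCoord E) (fun z => h.localPotential η.1 z.1) (extChartAt (dualModel I) η η) =
      1 - h.dualNormSq η := by
  rw [← one_sub_dualNormSq_extChartAt_symm (mem_extChartAt_target η), extChartAt_to_inv]

theorem discDefect_extChartAt_self_pos (hη : η ∈ h.discBundle) :
    0 < discDefect (fiberCoord E) (fun z => h.localPotential η.1 z.1)
      (extChartAt (dualModel I) η η) := by
  rw [discDefect_extChartAt_self]
  exact sub_pos.2 hη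

theorem contDiffAt_localPotential_fst :
    ContDiffAt ℝ ∞ (fun z : E × (ℂ →L[ℂ] ℂ) => h.localPotential η.1 z.1)
      (extChartAt (dualModel I) η η) := by
  refine ContDiffAt.fst'' ?_
  rw [extChartAt_dual_fst]
  exact h.contDiffAt_localPotential η.1

variable [I.Boundaryless]

theorem contDiffAt_log_one_sub_dualNormSq (hη : η ∈ h.discBundle) :
    ContDiffAt ℝ ∞ ((fun ξ => Real.log (1 - h.dualNormSq ξ)) ∘ (extChartAt (dualModel I) η).symm)
      (extChartAt (dualModel I) η η) := by
  refine ((contDiffAt_discDefect contDiffAt_localPotential_fst).log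
    (discDefect_extChartAt_self_pos hη).ne').congr_of_eventuallyEq ?_
  filter_upwards [extChartAt_target_mem_nhds (I := dualModel I) η] with w hw
  rw [Function.comp_apply, one_sub_dualNormSq_extChartAt_symm hw]

section Parametrization

variable {F : Type*} [NormedAddCommGroup F] [NormedSpace ℂ F] {Ψ : F → DualTotal L} {y : F}
  {v : F →L[ℂ] ℂ} {s : ∀ x, L x}

variable [ContMDiffVectorBundle ω ℂ L I]

theorem coeffs_discMetric (hΨ : ContMDiffAt 𝓘(ℂ, F) (dualModel I) ω Ψ y)
    (hy : Ψ y ∈ h.discBundle) (hs : IsHolomorphicFrameAt I s (Ψ y).1)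
    (hv : ∀ᶠ z in 𝓝 y, ((Ψ z).2 (s (Ψ z).1) : ℂ) = v z) :
    coeffs (dualModel I) (h.discMetric h.curvatureForm) Ψ y =
      potentialForm (discPotential v fun z => h.potential s (Ψ z).1) y := by
  have hψ := contMDiffAt_fst_comp hΨ
  have smooth : ContDiffAt ℝ 2 (fun z => h.potential s (Ψ z).1) y :=
    (h.contDiffAt_potential_comp hψ hs).of_le (by norm_cast)
  have defect_eq : (fun z => Real.log (1 - h.dualNormSq (Ψ z))) =ᶠ[𝓝 y]
      fun z => Real.log (discDefect v (fun z => h.potential s (Ψ z).1) z) := by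
    filter_upwards [hv, hψ.continuousAt.eventually hs.eventually_ne_zero] with z hvz hsz
    rw [h.one_sub_dualNormSq_eq_discDefect hsz hvz]
  have defect_pos : 0 < discDefect v (fun z => h.potential s (Ψ z).1) y := by
    rw [← h.one_sub_dualNormSq_eq_discDefect hs.ne_zero hv.self_of_nhds]
    exact sub_pos.2 hy
  have base_part : coeffs I h.curvatureForm (fun z => (Ψ z).1) y = _ :=
    h.coeffs_curvatureForm hψ hs
  have fibre_part : coeffs (dualModel I)
      (leviForm (dualModel I) fun ξ => Real.log (1 - h.dualNormSq ξ)) Ψ y = _ :=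
    funext₂ (coeffs_leviForm (hΨ.of_le le_top)
      ((contDiffAt_log_one_sub_dualNormSq hy).of_le (by norm_cast)))
  ext a b
  unfold discPotential
  rw [potentialForm_sub smooth ((contDiffAt_discDefect smooth).log defect_pos.ne'),
    ← potentialForm_congr defect_eq, ← base_part, coeffs_fst_comp _ hΨ]
  exact congrArg _ (congrFun₂ fibre_part a b)

end Parametrization

end HermitianLineMetric

end DualBundle

section DiscMetric

variable {E : Type*} [NormedAddCommGroup E] [NormedSpace ℂ E]
  {H : Type*} [TopologicalSpace H] {I : ModelWithCorners ℂ E H} [I.Boundaryless]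
  {M : Type*} [TopologicalSpace M] [ChartedSpace H M]
  {L : M → Type*} [∀ x, TopologicalSpace (L x)]
  [TopologicalSpace (TotalSpace ℂ L)] [FiberBundle ℂ L]

variable (I L) in
/-- The domain of the preferred frame of `L` at `p`, seen in the preferred chart at `p`. -/
def frameDomain (p : M) : Set E :=
  (extChartAt I p).target ∩ (extChartAt I p).symm ⁻¹' (trivializationAt ℂ L p).baseSet

theorem frameDomain_mem_nhds (p : M) : frameDomain I L p ∈ 𝓝 (extChartAt I p p) := by
  refine Filter.inter_mem (extChartAt_target_mem_nhds p)
    ((continuousAt_extChartAt_symm p).preimage_mem_nhds ?_)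
  rw [extChartAt_to_inv]
  exact (trivializationAt ℂ L p).open_baseSet.mem_nhds (FiberBundle.mem_baseSet_trivializationAt' p)

namespace HermitianLineMetric

variable [∀ x, AddCommGroup (L x)] [∀ x, Module ℂ (L x)] [VectorBundle ℂ ℂ L]
  [IsManifold I ω M] [ContMDiffVectorBundle ω ℂ L I] {h : HermitianLineMetric I L} {η : DualTotal L}

theorem coeffs_curvatureForm_extChartAt_symm_eventuallyEq (p : M) :
    coeffs I h.curvatureForm (extChartAt I p).symm =ᶠ[𝓝 (extChartAt I p p)]
      potentialForm (h.localPotential p) := by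
  filter_upwards [frameDomain_mem_nhds (L := L) p] with z hz
  exact h.coeffs_curvatureForm (contMDiffAt_extChartAt_symm hz.1)
    (isHolomorphicFrameAt_localFrame hz.2)

theorem coeffs_discMetric_extChartAt_symm_eventuallyEq (hη : η ∈ h.discBundle) :
    coeffs (dualModel I) (h.discMetric h.curvatureForm) (extChartAt (dualModel I) η).symm
      =ᶠ[𝓝 (extChartAt (dualModel I) η η)] potentialForm (h.localDiscPotential η) := by
  filter_upwards [extChartAt_target_mem_nhds (I := dualModel I) η,
    eventually_discDefect_pos contDiffAt_localPotential_fst.continuousAt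
      (discDefect_extChartAt_self_pos hη)] with w hw defect_pos
  have target_nhds := (isOpen_extChartAt_target (I := dualModel I) η).mem_nhds hw
  have mem_disc : (extChartAt (dualModel I) η).symm w ∈ h.discBundle := by
    rw [← one_sub_dualNormSq_extChartAt_symm hw] at defect_pos
    exact sub_pos.1 defect_pos
  have frame : IsHolomorphicFrameAt I (localFrame L η.1) ((extChartAt (dualModel I) η).symm w).1 :=
    isHolomorphicFrameAt_localFrame
      (by rw [extChartAt_dual_symm_fst hw]; exact (mem_extChartAt_dual_target.1 hw).2)
  rw [coeffs_discMetric (v := fiberCoord E) (contMDiffAt_extChartAt_symm hw) mem_disc frame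
    (Filter.mem_of_superset target_nhds fun z hz => extChartAt_dual_symm_apply_localFrame hz)]
  refine potentialForm_congr ?_
  filter_upwards [target_nhds] with z hz
  simp only [localDiscPotential, discPotential, discDefect, localPotential,
    extChartAt_dual_symm_fst hz]

theorem discMetric_eq_potentialForm (hη : η ∈ h.discBundle) :
    (h.discMetric h.curvatureForm η : E × (ℂ →L[ℂ] ℂ) → E × (ℂ →L[ℂ] ℂ) → ℂ) =
      potentialForm (h.localDiscPotential η) (extChartAt (dualModel I) η η) := by
  rw [← (coeffs_discMetric_extChartAt_symm_eventuallyEq hη).self_of_nhds,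
    coeffs_extChartAt_symm_self]

theorem isHermitianInner_discMetric (hη : η ∈ h.discBundle)
    (hp : IsHermitianInner (V := TangentSpace I η.1) (h.curvatureForm η.1)) :
    IsHermitianInner (V := E × (ℂ →L[ℂ] ℂ)) (h.discMetric h.curvatureForm η) := by
  rw [discMetric_eq_potentialForm hη]
  refine isHermitianInner_potentialForm_discPotential ?_ ?_ (discDefect_extChartAt_self_pos hη) <;>
    rw [extChartAt_dual_fst]
  · exact (h.contDiffAt_localPotential η.1).of_le (by norm_cast)
  · exact h.isHermitianInner_potentialForm_localPotential hp

theorem isKahlerOn_discMetric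
    (hpos : ∀ p, IsHermitianInner (V := TangentSpace I p) (h.curvatureForm p)) :
    IsKahlerOn (dualModel I) (h.discMetric h.curvatureForm) h.discBundle :=
  isKahlerOn_of_potential (fun η hη => isHermitianInner_discMetric hη (hpos η.1))
    h.localDiscPotential
    (fun _ hη => contDiffAt_discPotential contDiffAt_localPotential_fst
      (discDefect_extChartAt_self_pos hη))
    fun _ hη => coeffs_discMetric_extChartAt_symm_eventuallyEq hη

variable [FiniteDimensional ℂ E]

theorem holSectCurv_curvatureForm (p : M) (X : E) :
    holSectCurv I h.curvatureForm p X =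
      holSectCurvCoord (potentialForm (h.localPotential p)) (extChartAt I p p) X :=
  holSectCurvCoord_congr (coeffs_curvatureForm_extChartAt_symm_eventuallyEq p) X

theorem holSectCurv_discMetric (hη : η ∈ h.discBundle)
    (hp : IsHermitianInner (V := TangentSpace I η.1) (h.curvatureForm η.1))
    (U : TangentSpace (dualModel I) η) :
    holSectCurv (dualModel I) (h.discMetric h.curvatureForm) η U =
      -2 * ((h.discMetric h.curvatureForm η U U).re ^ 2 -
          (h.curvatureForm η.1 (dualProjDeriv η U) (dualProjDeriv η U)).re ^ 2 /
              (1 - h.dualNormSq η) *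
            (1 + 1 / 2 * holSectCurv I h.curvatureForm η.1 (dualProjDeriv η U))) /
        (h.discMetric h.curvatureForm η U U).re ^ 2 := by
  have base_point : (extChartAt (dualModel I) η η).1 = extChartAt I η.1 η.1 :=
    extChartAt_dual_fst η η
  have model_formula := holSectCurvCoord_discPotential_fiberCoord (φ := h.localPotential η.1)
    (by rw [base_point]; exact (h.contDiffAt_localPotential η.1).of_le (by norm_cast))
    (by rw [base_point]; exact h.isHermitianInner_potentialForm_localPotential hp)
    (discDefect_extChartAt_self_pos hη) U
  have curv_disc : _ = holSectCurvCoord (potentialForm (h.localDiscPotential η)) _ U :=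
    holSectCurvCoord_congr (coeffs_discMetric_extChartAt_symm_eventuallyEq hη) U
  rw [discDefect_extChartAt_self, base_point, ← holSectCurv_curvatureForm,
    ← dualProjDeriv_eq_fst η U, ← localDiscPotential, ← curv_disc,
    ← discMetric_eq_potentialForm hη, ← h.curvatureForm_eq_potentialForm] at model_formula
  exact model_formula

end HermitianLineMetric

end DiscMetric

section GeodesicChart

variable {E : Type*} [NormedAddCommGroup E] [NormedSpace ℂ E]
  {E' : Type*} [NormedAddCommGroup E'] [NormedSpace ℂ E']

/-- The quadratic map `y ↦ x + A y - B (A y, A y) / 2`, used to parametrize a neighbourhood of `x`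
by geodesic coordinates: `A` is then an orthonormal frame and `B` the Christoffel symbols. -/
noncomputable def quadraticParam (x : E) (A : E' →L[ℂ] E) (B : E →L[ℂ] E →L[ℂ] E) (y : E') : E :=
  x + A y - (2⁻¹ : ℂ) • B (A y) (A y)

variable {x : E} {A : E' →L[ℂ] E} {B : E →L[ℂ] E →L[ℂ] E}

theorem quadraticParam_zero : quadraticParam x A B 0 = x := by
  simp [quadraticParam]

theorem contDiff_quadraticParam {n : WithTop ℕ∞} : ContDiff ℂ n (quadraticParam x A B) := by
  have hA := A.contDiff (n := n)
  exact (contDiff_const.add hA).sub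
    (((B.contDiff.comp hA).clm_apply hA).const_smul (2⁻¹ : ℂ))

theorem hasFDerivAt_quadraticParam (hB : ∀ c a, B c a = B a c) (y : E') :
    HasFDerivAt (quadraticParam x A B) (A - (B (A y)).comp A) y := by
  have hA := A.hasFDerivAt (x := y)
  refine (((hasFDerivAt_const x y).add hA).sub
    (((B.hasFDerivAt.comp y hA).clm_apply hA).const_smul (2⁻¹ : ℂ))).congr_fderiv ?_
  ext a
  have half_add_half : (2⁻¹ : ℂ) • (B (A y) (A a) + B (A y) (A a)) = B (A y) (A a) := by
    rw [← two_smul ℂ, smul_smul, inv_mul_cancel₀ two_ne_zero, one_smul]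
  simpa [hB (A a) (A y)] using half_add_half

theorem hasFDerivAt_quadraticParam_zero (hB : ∀ c a, B c a = B a c) :
    HasFDerivAt (quadraticParam x A B) A 0 := by
  simpa using hasFDerivAt_quadraticParam (x := x) (A := A) hB 0

theorem fderiv_quadraticParam_apply (hB : ∀ c a, B c a = B a c) (y a : E') :
    fderiv ℂ (quadraticParam x A B) y a = A a - B.flip (A a) (A y) := by
  rw [(hasFDerivAt_quadraticParam hB y).fderiv]
  rfl

theorem hasFDerivAt_fderiv_quadraticParam (hB : ∀ c a, B c a = B a c) (y a : E') :
    HasFDerivAt (fun z => fderiv ℂ (quadraticParam x A B) z a) (-(B.flip (A a)).comp A) y := by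
  simp only [fderiv_quadraticParam_apply hB]
  exact ((B.flip (A a)).hasFDerivAt.comp y A.hasFDerivAt).const_sub (A a)

/-- The quadratic term of the parametrization cancels the Christoffel symbols. -/
theorem wirtinger_potentialForm_comp_quadraticParam {φ : E → ℝ} (hφ : ContDiffAt ℝ 3 φ x)
    (hB : ∀ c a, B c a = B a c) (christoffel : ∀ c a d,
      potentialForm φ x (B c a) d = wirtinger (fun y => potentialForm φ y a d) x c) (a b c : E') :
    wirtinger (fun y => potentialForm (fun z => φ (quadraticParam x A B z)) y a b) 0 c = 0 := by
  have hφ' : ContDiffAt ℝ 3 φ (quadraticParam x A B 0) := by rwa [quadraticParam_zero]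
  have hψ := hasFDerivAt_quadraticParam_zero (x := x) (A := A) hB
  have pullback : (fun y => potentialForm (fun z => φ (quadraticParam x A B z)) y a b) =ᶠ[𝓝 0]
      fun y => potentialForm φ (quadraticParam x A B y) (fderiv ℂ (quadraticParam x A B) y a)
        (fderiv ℂ (quadraticParam x A B) y b) := by
    filter_upwards [hψ.continuousAt.eventually (hφ'.eventually (by simp))] with y hy
    exact potentialForm_comp (hy.of_le (by norm_num)) contDiff_quadraticParam.contDiffAt a b
  rw [wirtinger_congr pullback, wirtinger_potentialForm_apply hφ' hψ.differentiableAt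
      (hasFDerivAt_fderiv_quadraticParam hB 0 a).differentiableAt
      (hasFDerivAt_fderiv_quadraticParam hB 0 b).differentiableAt,
    (hasFDerivAt_fderiv_quadraticParam hB 0 a).fderiv, hψ.fderiv, quadraticParam_zero,
    ← christoffel, ← potentialForm_add_left]
  simp [potentialForm_zero_left]

theorem exists_openPartialHomeomorph_symm_eq [CompleteSpace E'] {ψ : E' → E} {A : E' ≃L[ℂ] E}
    {y : E'} (hψ : ContDiff ℂ ω ψ) (hA : HasFDerivAt ψ (A : E' →L[ℂ] E) y) {S : Set E}
    (hS : S ∈ 𝓝 (ψ y)) :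
    ∃ κ : OpenPartialHomeomorph E E', ⇑κ.symm = ψ ∧ ψ y ∈ κ.source ∧ κ (ψ y) = y ∧
      κ.source ⊆ S ∧ ContDiffOn ℂ ω κ κ.source := by
  have hψy : ContDiffAt ℂ ω ψ y := hψ.contDiffAt
  have hω : (ω : WithTop ℕ∞) ≠ 0 := by simp
  let e := (hψy.toOpenPartialHomeomorph ψ hA hω).symm
  have smooth_inverse : ContDiffAt ℂ ω e (ψ y) := hψy.to_localInverse hA hω
  let T := {z | ContDiffAt ℂ ω e z} ∩ S
  have hT : T ∈ 𝓝 (ψ y) := Filter.inter_mem (smooth_inverse.eventually (by simp)) hS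
  have subset_T : (e.restr T).source ⊆ T := by
    rw [e.restr_source]
    exact Set.inter_subset_right.trans interior_subset
  refine ⟨e.restr T, rfl, ?_, hψy.localInverse_apply_image hA hω,
    fun z hz => (subset_T hz).2, fun z hz => ContDiffAt.contDiffWithinAt (subset_T hz).1⟩
  rw [e.restr_source]
  exact ⟨hψy.image_mem_toOpenPartialHomeomorph_target hA hω, mem_interior_iff_mem_nhds.2 hT⟩

/-- `κ` is a system of geodesic coordinates at `x`, centred at `0`, for the metric with potential
`φ` on an open subset of a vector space. -/
structure IsGeodesicChart {m : ℕ} (φ : E → ℝ) (x : E)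
    (κ : OpenPartialHomeomorph E (EuclideanSpace ℂ (Fin m))) : Prop where
  contDiffOn : ContDiffOn ℂ ω κ κ.source
  contDiffOn_symm : ContDiffOn ℂ ω κ.symm κ.target
  mem_source : x ∈ κ.source
  map_center : κ x = 0
  unit : ∀ a b, potentialForm (fun y => φ (κ.symm y)) 0 a b = ∑ j, a j * conj (b j)
  wirtinger_eq_zero : ∀ a b c,
    wirtinger (fun y => potentialForm (fun z => φ (κ.symm z)) y a b) 0 c = 0

theorem IsGeodesicChart.zero_mem_target {m : ℕ} {φ : E → ℝ}
    {κ : OpenPartialHomeomorph E (EuclideanSpace ℂ (Fin m))} (hκ : IsGeodesicChart φ x κ) :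
    0 ∈ κ.target :=
  hκ.map_center ▸ κ.map_source hκ.mem_source

theorem exists_isGeodesicChart [FiniteDimensional ℂ E] {m : ℕ} (hm : Module.finrank ℂ E = m)
    {φ : E → ℝ} (hφ : ContDiffAt ℝ 3 φ x) (hg : IsHermitianInner (potentialForm φ x)) {S : Set E}
    (hS : S ∈ 𝓝 x) :
    ∃ κ : OpenPartialHomeomorph E (EuclideanSpace ℂ (Fin m)),
      IsGeodesicChart φ x κ ∧ κ.source ⊆ S := by
  obtain ⟨A, orthonormal⟩ := hg.exists_euclidean_equiv hm
  obtain ⟨B, hB, christoffel⟩ := exists_christoffel hφ hg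
  let ψ := quadraticParam x (A : EuclideanSpace ℂ (Fin m) →L[ℂ] E) B
  have hψ0 : ψ 0 = x := quadraticParam_zero
  have hψ : ContDiff ℂ ω ψ := contDiff_quadraticParam
  have hψA : HasFDerivAt ψ _ 0 := hasFDerivAt_quadraticParam_zero hB
  obtain ⟨κ, hκψ, hx, hκx, hκS, hκ⟩ := exists_openPartialHomeomorph_symm_eq hψ hψA (hψ0.symm ▸ hS)
  rw [hψ0] at hx hκx
  refine ⟨κ, ⟨hκ, hκψ ▸ hψ.contDiffOn, hx, hκx, fun a b => ?_, fun a b c => ?_⟩, hκS⟩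
  · rw [hκψ, potentialForm_comp (by rw [hψ0]; exact hφ.of_le (by norm_num))
      (hψ.contDiffAt.of_le le_top), hψA.fderiv, hψ0]
    exact orthonormal a b
  · rw [hκψ]
    exact wirtinger_potentialForm_comp_quadraticParam hφ hB christoffel a b c

end GeodesicChart

section NormalizingFactor

variable {E : Type*} [NormedAddCommGroup E] [NormedSpace ℂ E] {χ : E → ℝ} {x : E}

/-- The holomorphic factor `exp (χ(x)/2 + ∂χ_x(y - x))`: multiplying a frame with potential `χ` by
it makes the potential vanish to first order at `x`. -/
noncomputable def normalizingFactor (χ : E → ℝ) (x y : E) : ℂ :=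
  Complex.exp (χ x / 2 + wirtingerCLM (fun z => (χ z : ℂ)) x (y - x))

theorem normalizingFactor_ne_zero (χ : E → ℝ) (x y : E) : normalizingFactor χ x y ≠ 0 :=
  Complex.exp_ne_zero _

theorem contDiff_normalizingFactor {n : WithTop ℕ∞} : ContDiff ℂ n (normalizingFactor χ x) :=
  (contDiff_const.add ((ContinuousLinearMap.contDiff _).comp (contDiff_id.sub contDiff_const))).cexp

theorem log_norm_sq_normalizingFactor (χ : E → ℝ) (x y : E) :
    Real.log (‖normalizingFactor χ x y‖ ^ 2) =
      χ x + 2 * (wirtinger (fun z => (χ z : ℂ)) x (y - x)).re := by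
  rw [normalizingFactor, Complex.norm_exp, ← Real.exp_nat_mul, Real.log_exp]
  simp only [Nat.cast_ofNat, wirtingerCLM_apply, Complex.add_re, Complex.div_ofNat_re,
    Complex.ofReal_re]
  ring

theorem sub_log_norm_sq_normalizingFactor_self (χ : E → ℝ) (x : E) :
    χ x - Real.log (‖normalizingFactor χ x x‖ ^ 2) = 0 := by
  rw [log_norm_sq_normalizingFactor, sub_self, wirtinger_zero_right]
  simp

theorem wirtinger_sub_log_norm_sq_normalizingFactor (hχ : DifferentiableAt ℝ χ x) (a : E) :
    wirtinger (fun y => ((χ y - Real.log (‖normalizingFactor χ x y‖ ^ 2) : ℝ) : ℂ)) x a = 0 := by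
  let ℓ := wirtingerCLM (fun z => (χ z : ℂ)) x
  have hℓ : HasFDerivAt (fun y => ℓ (y - x)) ℓ x :=
    ℓ.hasFDerivAt.comp x (f := fun y => y - x) ((hasFDerivAt_id x).sub_const x)
  have hol := HasWirtingerAt.of_holomorphic hℓ.differentiableAt a
  rw [hℓ.fderiv] at hol
  refine (((hasWirtingerAt_ofReal hχ a).sub ((HasWirtingerAt.const (χ x : ℂ) x a).add
    (hol.add hol.star))).congr_of_eventuallyEq (.of_forall fun y => ?_)).wirtinger_eq.trans ?_
  · have two_re := Complex.add_conj (ℓ (y - x))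
    simp only [log_norm_sq_normalizingFactor]
    push_cast at two_re ⊢
    rw [two_re]
    simp [ℓ]
  · simp [ℓ]

end NormalizingFactor

section DiscPotential

variable {E : Type*} [NormedAddCommGroup E] [NormedSpace ℂ E]

theorem discPotential_congr {v : E →L[ℂ] ℂ} {φ χ : E → ℝ} {x : E} (h : φ =ᶠ[𝓝 x] χ) :
    discPotential v φ =ᶠ[𝓝 x] discPotential v χ := by
  filter_upwards [h] with y hy
  simp only [discPotential, discDefect, hy]

/-- The connection form of `L*` reduces to `dv` where the frame is normalized to first order. -/
theorem potentialForm_discPotential_snd {χ : E → ℝ} {w : E × ℂ} (hχ : ContDiffAt ℝ 2 χ w.1)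
    (hχ0 : χ w.1 = 0) (hdχ : ∀ a, wirtinger (fun y => (χ y : ℂ)) w.1 a = 0) (hw : ‖w.2‖ < 1)
    (a b : E) (α β : ℂ) :
    potentialForm (discPotential (ContinuousLinearMap.snd ℂ E ℂ) fun q => χ q.1) w (a, α) (b, β) =
      (1 / (1 - ‖w.2‖ ^ 2) : ℝ) *
        ((1 / (1 - ‖w.2‖ ^ 2) : ℝ) * (α * conj β) + potentialForm χ w.1 a b) := by
  have defect_eq : discDefect (ContinuousLinearMap.snd ℂ E ℂ) (fun q => χ q.1) w =
      1 - ‖w.2‖ ^ 2 := by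
    simp [discDefect, hχ0]
  have conn_eq (u : E × ℂ) :
      connForm (ContinuousLinearMap.snd ℂ E ℂ) (fun q => χ q.1) w u = u.2 := by
    rw [connForm, wirtinger_comp_fst (f := fun y => (χ y : ℂ))
      ((contDiffAt_ofReal hχ).differentiableAt two_ne_zero), hdχ, mul_zero, add_zero]
    rfl
  have defect_pos : 0 < 1 - ‖w.2‖ ^ 2 := sub_pos.2 ((sq_lt_one_iff₀ (norm_nonneg _)).2 hw)
  rw [potentialForm_discPotential hχ.fst'' (by rwa [defect_eq]), potentialForm_comp_fst hχ,
    defect_eq, conn_eq, conn_eq, hχ0, Real.exp_zero]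
  have defect_ne : (1 - ‖w.2‖ ^ 2 : ℂ) ≠ 0 := by exact_mod_cast defect_pos.ne'
  push_cast
  field_simp
  ring

end DiscPotential

section Charts

variable {E : Type*} [NormedAddCommGroup E] [NormedSpace ℂ E]
  {H : Type*} [TopologicalSpace H] {I : ModelWithCorners ℂ E H}
  {N : Type*} [TopologicalSpace N] [ChartedSpace H N]
  {E' : Type*} [NormedAddCommGroup E'] [NormedSpace ℂ E']

theorem IsHolomorphicChart.contMDiffAt_symm {Φ : OpenPartialHomeomorph N E'}
    (hΦ : IsHolomorphicChart I Φ) {p : N} (hp : p ∈ Φ.source) :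
    ContMDiffAt 𝓘(ℂ, E') I ω Φ.symm (Φ p) :=
  hΦ.holo_symm.contMDiffAt (Φ.open_target.mem_nhds (Φ.map_source hp))

variable [I.Boundaryless]

/-- The preferred chart `extChartAt I p` of a manifold without boundary, as an open partial
homeomorphism. -/
noncomputable def extChartHomeo (I : ModelWithCorners ℂ E H) [I.Boundaryless] (p : N) :
    OpenPartialHomeomorph N E :=
  (chartAt H p).trans I.toHomeomorph.toOpenPartialHomeomorph

theorem extChartHomeo_source (p : N) : (extChartHomeo I p).source = (extChartAt I p).source := by
  simp [extChartHomeo]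

theorem extChartHomeo_target (p : N) : (extChartHomeo I p).target = (extChartAt I p).target := by
  rw [← (extChartHomeo I p).image_source_eq_target, extChartHomeo_source,
    ← (extChartAt I p).image_source_eq_target]
  rfl

theorem mem_extChartHomeo_trans_source {F : Type*} [TopologicalSpace F] {p q : N}
    {κ : OpenPartialHomeomorph E F} :
    q ∈ ((extChartHomeo I p).trans κ).source ↔
      q ∈ (extChartAt I p).source ∧ extChartAt I p q ∈ κ.source := by
  rw [OpenPartialHomeomorph.trans_source, extChartHomeo_source]
  rfl

theorem isHolomorphicChart_extChartHomeo_trans [IsManifold I ω N] (p : N)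
    {κ : OpenPartialHomeomorph E E'} (hκ : ContDiffOn ℂ ω κ κ.source)
    (hκsymm : ContDiffOn ℂ ω κ.symm κ.target) :
    IsHolomorphicChart I ((extChartHomeo I p).trans κ) where
  holo := by
    refine hκ.contMDiffOn.comp ((contMDiffOn_extChartAt (x := p)).mono fun q hq => ?_)
      fun q hq => hq.2
    simpa using (mem_extChartHomeo_trans_source.1 hq).1
  holo_symm := by
    rw [OpenPartialHomeomorph.trans_target, extChartHomeo_target]
    exact (contMDiffOn_extChartAt_symm p).comp (hκsymm.contMDiffOn.mono fun y hy => hy.1)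
      fun q hq => hq.2

end Charts

section LineCoordinates

variable {E : Type*} [NormedAddCommGroup E] [NormedSpace ℂ E]
  {E' : Type*} [NormedAddCommGroup E'] [NormedSpace ℂ E']

/-- The coordinates `(κ w, f(κ w) v)` on the model `E × Hom(ℂ, ℂ)` of the dual line bundle, where
`v` is the fibre coordinate. -/
noncomputable def lineCoordinates (κ : OpenPartialHomeomorph E E') (f : E' → ℂ)
    (hf : Continuous f) (hf0 : ∀ y, f y ≠ 0) :
    OpenPartialHomeomorph (E × (ℂ →L[ℂ] ℂ)) (E' × ℂ) where
  toFun w := (κ w.1, f (κ w.1) * fiberCoord E w)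
  invFun q := (κ.symm q.1, (q.2 / f q.1) • ContinuousLinearMap.id ℂ ℂ)
  source := κ.source ×ˢ Set.univ
  target := κ.target ×ˢ Set.univ
  map_source' w hw := ⟨κ.map_source hw.1, trivial⟩
  map_target' q hq := ⟨κ.map_target hq.1, trivial⟩
  left_inv' w hw := by
    refine Prod.ext (κ.left_inv hw.1) (ContinuousLinearMap.ext_ring ?_)
    simp [fiberCoord_apply, hf0 (κ w.1)]
  right_inv' q hq := by
    refine Prod.ext (κ.right_inv hq.1) ?_
    simp [fiberCoord_apply, κ.right_inv hq.1, mul_div_cancel₀ _ (hf0 q.1)]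
  open_source := κ.open_source.prod isOpen_univ
  open_target := κ.open_target.prod isOpen_univ
  continuousOn_toFun := by
    have base : ContinuousOn (fun w : E × (ℂ →L[ℂ] ℂ) => κ w.1) (κ.source ×ˢ Set.univ) :=
      κ.continuousOn.comp continuousOn_fst fun w hw => hw.1
    exact base.prodMk ((hf.comp_continuousOn base).mul (fiberCoord E).continuous.continuousOn)
  continuousOn_invFun := by
    have base : ContinuousOn (fun q : E' × ℂ => κ.symm q.1) (κ.target ×ˢ Set.univ) :=
      κ.continuousOn_symm.comp continuousOn_fst fun w hw => hw.1
    refine base.prodMk (Continuous.continuousOn ?_)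
    exact (continuous_snd.div (hf.comp continuous_fst) fun q => hf0 q.1).smul continuous_const

variable {κ : OpenPartialHomeomorph E E'} {f : E' → ℂ}

theorem contDiffOn_lineCoordinates (hκ : ContDiffOn ℂ ω κ κ.source) (hf : ContDiff ℂ ω f)
    (hf0 : ∀ y, f y ≠ 0) : ContDiffOn ℂ ω (lineCoordinates κ f hf.continuous hf0)
      (lineCoordinates κ f hf.continuous hf0).source := by
  have base : ContDiffOn ℂ ω (fun w : E × (ℂ →L[ℂ] ℂ) => κ w.1) (κ.source ×ˢ Set.univ) :=
    hκ.comp contDiffOn_fst fun w hw => hw.1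
  exact base.prodMk ((hf.comp_contDiffOn base).mul (fiberCoord E).contDiff.contDiffOn)

theorem contDiffOn_lineCoordinates_symm (hκ : ContDiffOn ℂ ω κ.symm κ.target)
    (hf : ContDiff ℂ ω f) (hf0 : ∀ y, f y ≠ 0) :
    ContDiffOn ℂ ω (lineCoordinates κ f hf.continuous hf0).symm
      (lineCoordinates κ f hf.continuous hf0).target := by
  have base : ContDiffOn ℂ ω (fun q : E' × ℂ => κ.symm q.1) (κ.target ×ˢ Set.univ) :=
    hκ.comp contDiffOn_fst fun w hw => hw.1
  have fiber : ContDiff ℂ ω (fun q : E' × ℂ => (q.2 / f q.1) • ContinuousLinearMap.id ℂ ℂ) :=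
    (contDiff_snd.div (hf.comp contDiff_fst) fun q => hf0 q.1).smul contDiff_const
  exact base.prodMk fiber.contDiffOn

end LineCoordinates

section DualChart

variable {E : Type*} [NormedAddCommGroup E] [NormedSpace ℂ E]
  {H : Type*} [TopologicalSpace H] {I : ModelWithCorners ℂ E H}
  {M : Type*} [TopologicalSpace M] [ChartedSpace H M]
  {L : M → Type*} [∀ x, AddCommGroup (L x)] [∀ x, Module ℂ (L x)] [∀ x, TopologicalSpace (L x)]
  [TopologicalSpace (TotalSpace ℂ L)] [FiberBundle ℂ L] [VectorBundle ℂ ℂ L]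
  {E' : Type*} [NormedAddCommGroup E'] [NormedSpace ℂ E']

/-- `Φ` is the coordinate system `(z, v)`, `v(η) = η(s)`, of `L*` induced by the coordinates `z`
of `M` and the section `s` of `L`. -/
structure IsDualChart (I : ModelWithCorners ℂ E H) (z : OpenPartialHomeomorph M E') (s : ∀ x, L x)
    (Φ : OpenPartialHomeomorph (DualTotal L) (E' × ℂ)) : Prop where
  isHolomorphicChart : IsHolomorphicChart (dualModel I) Φ
  source_eq : Φ.source = {η | η.1 ∈ z.source}
  apply_eq : ∀ η ∈ Φ.source, Φ η = (z η.1, η.2 (s η.1))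

namespace IsDualChart

variable {z : OpenPartialHomeomorph M E'} {s : ∀ x, L x}
  {Φ : OpenPartialHomeomorph (DualTotal L) (E' × ℂ)} (hΦ : IsDualChart I z s Φ) {w : E' × ℂ}
include hΦ

theorem mem_source {η : DualTotal L} (hη : η.1 ∈ z.source) : η ∈ Φ.source := by
  rwa [hΦ.source_eq]

theorem eq_of_mem_target (hw : w ∈ Φ.target) :
    (z (Φ.symm w).1, ((Φ.symm w).2 (s (Φ.symm w).1) : ℂ)) = w := by
  rw [← hΦ.apply_eq _ (Φ.map_target hw), Φ.right_inv hw]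

theorem symm_fst (hw : w ∈ Φ.target) : (Φ.symm w).1 = z.symm w.1 := by
  have hz : (Φ.symm w).1 ∈ z.source := hΦ.source_eq.subset (Φ.map_target hw)
  have coord : z (Φ.symm w).1 = w.1 := congrArg Prod.fst (hΦ.eq_of_mem_target hw)
  rw [← coord, z.left_inv hz]

theorem symm_apply_frame (hw : w ∈ Φ.target) :
    ((Φ.symm w).2 (s (Φ.symm w).1) : ℂ) = w.2 :=
  congrArg Prod.snd (hΦ.eq_of_mem_target hw)

end IsDualChart

variable {η : DualTotal L}

theorem HermitianLineMetric.dualNormSq_eq_of_isDualChart {h : HermitianLineMetric I L}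
    {z : OpenPartialHomeomorph M E'} {s : ∀ x, L x}
    {Φ : OpenPartialHomeomorph (DualTotal L) (E' × ℂ)} (hΦ : IsDualChart I z s Φ)
    (hη : η.1 ∈ z.source) (hs : h.normSq (s η.1) = 1) :
    h.dualNormSq η = ‖(Φ η).2‖ ^ 2 := by
  have s_ne_zero := h.ne_zero_of_normSq_eq_one hs
  rw [h.dualNormSq_eq η s_ne_zero, h.exp_potential s_ne_zero, hs, hΦ.apply_eq η (hΦ.mem_source hη)]
  simp

theorem mem_extChartAt_dual_source {ξ : DualTotal L} :
    ξ ∈ (extChartAt (dualModel I) η).source ↔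
      ξ.1 ∈ (extChartAt I η.1).source ∧ ξ.1 ∈ (trivializationAt ℂ L η.1).baseSet := by
  rw [extChartAt_source, FiberBundle.chartedSpace_chartAt, extChartAt_source]
  simp only [mfld_simps, Bundle.Trivial.fiberBundle_trivializationAt',
    Bundle.Trivial.trivialization_baseSet, Set.inter_univ]
  exact and_comm

variable [I.Boundaryless] [ContMDiffVectorBundle ω ℂ L I]
  {κ : OpenPartialHomeomorph E E'} {f : E' → ℂ}

theorem isDualChart_lineCoordinates [IsManifold I ω M] (hκ : ContDiffOn ℂ ω κ κ.source)
    (hκsymm : ContDiffOn ℂ ω κ.symm κ.target) (hf : ContDiff ℂ ω f) (hf0 : ∀ y, f y ≠ 0)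
    (hbase : ((extChartHomeo I η.1).trans κ).source ⊆ (trivializationAt ℂ L η.1).baseSet) :
    IsDualChart I ((extChartHomeo I η.1).trans κ)
      (fun x => f (κ (extChartAt I η.1 x)) • localFrame L η.1 x)
      ((extChartHomeo (dualModel I) η).trans (lineCoordinates κ f hf.continuous hf0)) := by
  have source_eq : ((extChartHomeo (dualModel I) η).trans
      (lineCoordinates κ f hf.continuous hf0)).source =
      {ξ | ξ.1 ∈ ((extChartHomeo I η.1).trans κ).source} := by
    ext ξ
    have fiber_total : extChartAt (dualModel I) η ξ ∈
        (lineCoordinates κ f hf.continuous hf0).source ↔ extChartAt I η.1 ξ.1 ∈ κ.source := by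
      rw [← extChartAt_dual_fst η ξ]
      exact and_iff_left trivial
    change _ ↔ ξ.1 ∈ ((extChartHomeo I η.1).trans κ).source
    rw [mem_extChartHomeo_trans_source, mem_extChartAt_dual_source, fiber_total,
      mem_extChartHomeo_trans_source]
    exact ⟨fun hξ => ⟨hξ.1.1, hξ.2⟩,
      fun hξ => ⟨⟨hξ.1, hbase (mem_extChartHomeo_trans_source.2 hξ)⟩, hξ.2⟩⟩
  refine ⟨isHolomorphicChart_extChartHomeo_trans η (contDiffOn_lineCoordinates hκ hf hf0)
    (contDiffOn_lineCoordinates_symm hκsymm hf hf0), source_eq, fun ξ hξ => ?_⟩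
  rw [source_eq] at hξ
  change (κ (extChartAt (dualModel I) η ξ).1, f (κ (extChartAt (dualModel I) η ξ).1) *
    fiberCoord E (extChartAt (dualModel I) η ξ)) = _
  rw [extChartAt_dual_fst, fiberCoord_extChartAt (hbase hξ), map_smul]
  rfl

namespace HermitianLineMetric

variable {h : HermitianLineMetric I L} {z : OpenPartialHomeomorph M E'} {s : ∀ x, L x}
  {Φ : OpenPartialHomeomorph (DualTotal L) (E' × ℂ)}

theorem coeffs_discMetric_of_isDualChart (hz : IsHolomorphicChart I z) (hΦ : IsDualChart I z s Φ)
    (hη : η ∈ h.discBundle) (hηz : η.1 ∈ z.source) (hs : IsHolomorphicFrameAt I s η.1)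
    (hs1 : h.normSq (s η.1) = 1)
    (hds : ∀ a, wirtinger (fun y => (h.potential s (z.symm y) : ℂ)) (z η.1) a = 0)
    (a b : E') (α β : ℂ) :
    coeffs (dualModel I) (h.discMetric h.curvatureForm) Φ.symm (Φ η) (a, α) (b, β) =
      (1 / (1 - ‖(Φ η).2‖ ^ 2) : ℝ) *
        ((1 / (1 - ‖(Φ η).2‖ ^ 2) : ℝ) * (α * conj β) +
          coeffs I h.curvatureForm z.symm (z η.1) a b) := by
  have hηΦ := hΦ.mem_source hηz
  have target_nhds := Φ.open_target.mem_nhds (Φ.map_source hηΦ)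
  have base_eq : (Φ η).1 = z η.1 := congrArg Prod.fst (hΦ.apply_eq η hηΦ)
  have frame : IsHolomorphicFrameAt I s (z.symm (z η.1)) := by rwa [z.left_inv hηz]
  have hz_symm := hz.contMDiffAt_symm hηz
  have potential_eq : (fun w => h.potential s (Φ.symm w).1) =ᶠ[𝓝 (Φ η)]
      fun w => h.potential s (z.symm w.1) := by
    filter_upwards [target_nhds] with w hw
    rw [hΦ.symm_fst hw]
  rw [coeffs_discMetric (v := ContinuousLinearMap.snd ℂ E' ℂ)
      (hΦ.isHolomorphicChart.contMDiffAt_symm hηΦ) (by rwa [Φ.left_inv hηΦ])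
      (by rwa [Φ.left_inv hηΦ])
      (Filter.mem_of_superset target_nhds fun w hw => hΦ.symm_apply_frame hw),
    h.coeffs_curvatureForm hz_symm frame, potentialForm_congr (discPotential_congr potential_eq),
    ← base_eq]
  refine potentialForm_discPotential_snd (χ := fun y => h.potential s (z.symm y))
    ?_ ?_ ?_ ?_ a b α β
  · rw [base_eq]
    exact (h.contDiffAt_potential_comp hz_symm frame).of_le (by norm_cast)
  · rw [base_eq, z.left_inv hηz, potential, hs1, Real.log_one, neg_zero]
  · rwa [base_eq]
  · rw [← sq_lt_one_iff₀ (norm_nonneg _), ← dualNormSq_eq_of_isDualChart hΦ hηz hs1]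
    exact hη

end HermitianLineMetric

end DualChart

section AdaptedCoordinates

variable {E : Type*} [NormedAddCommGroup E] [NormedSpace ℂ E]
  {H : Type*} [TopologicalSpace H] {I : ModelWithCorners ℂ E H}
  {M : Type*} [TopologicalSpace M] [ChartedSpace H M]
  {L : M → Type*} [∀ x, TopologicalSpace (L x)]
  [TopologicalSpace (TotalSpace ℂ L)] [FiberBundle ℂ L]

theorem extChartHomeo_trans_source_subset_baseSet [I.Boundaryless] {F : Type*}
    [TopologicalSpace F] {p : M} {κ : OpenPartialHomeomorph E F}
    (hκS : κ.source ⊆ frameDomain I L p) :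
    ((extChartHomeo I p).trans κ).source ⊆ (trivializationAt ℂ L p).baseSet := by
  intro q hq
  obtain ⟨mem_source, mem_κ⟩ := mem_extChartHomeo_trans_source.1 hq
  have := (hκS mem_κ).2
  rwa [Set.mem_preimage, (extChartAt I p).left_inv mem_source] at this

namespace HermitianLineMetric

variable [∀ x, AddCommGroup (L x)] [∀ x, Module ℂ (L x)] {h : HermitianLineMetric I L}
  {m : ℕ} {p : M} {κ : OpenPartialHomeomorph E (EuclideanSpace ℂ (Fin m))}

/-- The local potential of `h` at `p` in the coordinates `κ ∘ extChartAt I p`. -/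
noncomputable def chartPotential (h : HermitianLineMetric I L) (p : M)
    (κ : OpenPartialHomeomorph E (EuclideanSpace ℂ (Fin m))) (y : EuclideanSpace ℂ (Fin m)) : ℝ :=
  h.localPotential p (κ.symm y)

/-- The preferred frame at `p`, rescaled so that its potential vanishes to first order at the
origin of the coordinates `κ ∘ extChartAt I p`. -/
noncomputable def normalizedFrame (h : HermitianLineMetric I L) (p : M)
    (κ : OpenPartialHomeomorph E (EuclideanSpace ℂ (Fin m))) (x : M) : L x :=
  normalizingFactor (h.chartPotential p κ) 0 (κ (extChartAt I p x)) • localFrame L p x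

variable [VectorBundle ℂ ℂ L]

theorem contDiffAt_chartPotential (hκ : IsGeodesicChart (h.localPotential p) (extChartAt I p p) κ) :
    ContDiffAt ℝ ∞ (h.chartPotential p κ) 0 := by
  have hx : κ.symm 0 = extChartAt I p p := by rw [← hκ.map_center, κ.left_inv hκ.mem_source]
  have hsymm : ContDiffAt ℂ ω κ.symm 0 :=
    hκ.contDiffOn_symm.contDiffAt (κ.open_target.mem_nhds hκ.zero_mem_target)
  exact ContDiffAt.comp 0 (hx ▸ h.contDiffAt_localPotential p)
    ((hsymm.restrict_scalars ℝ).of_le le_top)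

variable [I.Boundaryless]

theorem potential_normalizedFrame
    (hκS : κ.source ⊆ frameDomain I L p)
    {y : EuclideanSpace ℂ (Fin m)} (hy : y ∈ κ.target) :
    h.potential (h.normalizedFrame p κ) (((extChartHomeo I p).trans κ).symm y) =
      h.chartPotential p κ y -
        Real.log (‖normalizingFactor (h.chartPotential p κ) 0 y‖ ^ 2) := by
  obtain ⟨mem_target, mem_baseSet⟩ := hκS (κ.map_target hy)
  change h.potential (fun x => normalizingFactor (h.chartPotential p κ) 0 (κ (extChartAt I p x)) •
    localFrame L p x) ((extChartAt I p).symm (κ.symm y)) = _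
  rw [h.potential_smul
      (c := fun x => normalizingFactor (h.chartPotential p κ) 0 (κ (extChartAt I p x)))
      (normalizingFactor_ne_zero _ _ _) (localFrame_ne_zero mem_baseSet),
    (extChartAt I p).right_inv mem_target, κ.right_inv hy]
  rfl

theorem normSq_normalizedFrame (hκ : IsGeodesicChart (h.localPotential p) (extChartAt I p p) κ)
    (hκS : κ.source ⊆ frameDomain I L p) :
    h.normSq (h.normalizedFrame p κ p) = 1 := by
  have frame_ne : h.normalizedFrame p κ p ≠ 0 :=
    smul_ne_zero (normalizingFactor_ne_zero _ _ _)
      (localFrame_ne_zero (FiberBundle.mem_baseSet_trivializationAt' p))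
  have potential_zero := h.potential_normalizedFrame hκS hκ.zero_mem_target
  have center : ((extChartHomeo I p).trans κ).symm 0 = p := by
    change (extChartAt I p).symm (κ.symm 0) = p
    rw [← hκ.map_center, κ.left_inv hκ.mem_source, extChartAt_to_inv]
  rw [sub_log_norm_sq_normalizingFactor_self, center] at potential_zero
  rw [← inv_inj, inv_one, ← h.exp_potential frame_ne, potential_zero, Real.exp_zero]

theorem wirtinger_potential_normalizedFrame
    (hκ : IsGeodesicChart (h.localPotential p) (extChartAt I p p) κ)
    (hκS : κ.source ⊆ frameDomain I L p)
    (a : EuclideanSpace ℂ (Fin m)) :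
    wirtinger (fun y => (h.potential (h.normalizedFrame p κ)
      (((extChartHomeo I p).trans κ).symm y) : ℂ)) 0 a = 0 := by
  rw [← wirtinger_sub_log_norm_sq_normalizingFactor
    ((contDiffAt_chartPotential hκ).differentiableAt (by simp)) a]
  refine wirtinger_congr ?_ a
  filter_upwards [κ.open_target.mem_nhds hκ.zero_mem_target] with y hy
  rw [h.potential_normalizedFrame hκS hy]

variable [ContMDiffVectorBundle ω ℂ L I] [IsManifold I ω M]

theorem contMDiffOn_normalizedFrame (hκ : ContDiffOn ℂ ω κ κ.source)
    (hκS : κ.source ⊆ frameDomain I L p) :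
    ContMDiffOn I (I.prod 𝓘(ℂ, ℂ)) ω (fun x => TotalSpace.mk' ℂ x (h.normalizedFrame p κ x))
      ((extChartHomeo I p).trans κ).source := by
  refine contMDiffOn_smul_localFrame ?_ (extChartHomeo_trans_source_subset_baseSet hκS)
  refine contDiff_normalizingFactor.contMDiff.comp_contMDiffOn
    (hκ.contMDiffOn.comp (t := κ.source) ?_ fun q hq => hq.2)
  exact contMDiffOn_extChartAt.mono fun q hq => by
    simpa using (mem_extChartHomeo_trans_source.1 hq).1

theorem coeffs_curvatureForm_geodesicChart_eventuallyEq
    (hκ : IsGeodesicChart (h.localPotential p) (extChartAt I p p) κ)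
    (hκS : κ.source ⊆ frameDomain I L p) :
    coeffs I h.curvatureForm ((extChartHomeo I p).trans κ).symm =ᶠ[𝓝 0]
      potentialForm (h.chartPotential p κ) := by
  filter_upwards [κ.open_target.mem_nhds hκ.zero_mem_target] with y hy
  obtain ⟨mem_target, mem_baseSet⟩ := hκS (κ.map_target hy)
  refine h.coeffs_curvatureForm ?_ (isHolomorphicFrameAt_localFrame mem_baseSet)
  exact (contMDiffAt_extChartAt_symm mem_target).comp y
    (hκ.contDiffOn_symm.contDiffAt (κ.open_target.mem_nhds hy)).contMDiffAt

theorem isGeodesicAt_extChartHomeo_trans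
    (hκ : IsGeodesicChart (h.localPotential p) (extChartAt I p p) κ)
    (hκS : κ.source ⊆ frameDomain I L p) :
    IsGeodesicAt I h.curvatureForm ((extChartHomeo I p).trans κ) p := by
  have coeffs_eq := coeffs_curvatureForm_geodesicChart_eventuallyEq hκ hκS
  have center : ((extChartHomeo I p).trans κ) p = 0 := hκ.map_center
  refine ⟨isHolomorphicChart_extChartHomeo_trans p hκ.contDiffOn hκ.contDiffOn_symm,
    mem_extChartHomeo_trans_source.2 ⟨mem_extChartAt_source p, hκ.mem_source⟩, fun a b => ?_,
    fun a b c => ?_⟩ <;> rw [center]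
  · rw [coeffs_eq.self_of_nhds]
    exact hκ.unit a b
  · have coeff_eq : (fun y => coeffs I h.curvatureForm ((extChartHomeo I p).trans κ).symm y a b)
        =ᶠ[𝓝 0] fun y => potentialForm (h.chartPotential p κ) y a b :=
      coeffs_eq.mono fun y hy => congrFun₂ hy a b
    have smooth := (contDiffAt_chartPotential hκ).of_le (m := 2) (by norm_cast)
    rw [wirtinger_congr coeff_eq, wirtingerBar_congr coeff_eq, wirtingerBar_potentialForm smooth]
    exact ⟨hκ.wirtinger_eq_zero a b c,
      (congrArg _ (hκ.wirtinger_eq_zero b a c)).trans (map_zero _)⟩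

theorem exists_adapted_coordinates [FiniteDimensional ℂ E] (hm : Module.finrank ℂ E = m)
    {η : DualTotal L} (hp : IsHermitianInner (V := TangentSpace I η.1) (h.curvatureForm η.1)) :
    ∃ (z : OpenPartialHomeomorph M (EuclideanSpace ℂ (Fin m))) (s : ∀ x, L x)
      (Φ : OpenPartialHomeomorph (DualTotal L) (EuclideanSpace ℂ (Fin m) × ℂ)),
      IsGeodesicAt I h.curvatureForm z η.1 ∧
      ContMDiffOn I (I.prod 𝓘(ℂ, ℂ)) ω (fun x => TotalSpace.mk' ℂ x (s x)) z.source ∧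
      h.normSq (s η.1) = 1 ∧
      (∀ a, wirtinger (fun y => (h.potential s (z.symm y) : ℂ)) (z η.1) a = 0) ∧
      IsDualChart I z s Φ := by
  obtain ⟨κ, hκ, hκS⟩ := exists_isGeodesicChart hm
    ((h.contDiffAt_localPotential η.1).of_le (by norm_cast))
    (h.isHermitianInner_potentialForm_localPotential hp) (frameDomain_mem_nhds (L := L) η.1)
  have center : ((extChartHomeo I η.1).trans κ) η.1 = 0 := hκ.map_center
  exact ⟨(extChartHomeo I η.1).trans κ, h.normalizedFrame η.1 κ, _,
    isGeodesicAt_extChartHomeo_trans hκ hκS, contMDiffOn_normalizedFrame hκ.contDiffOn hκS,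
    normSq_normalizedFrame hκ hκS,
    fun a => center.symm ▸ wirtinger_potential_normalizedFrame hκ hκS a,
    isDualChart_lineCoordinates hκ.contDiffOn hκ.contDiffOn_symm contDiff_normalizingFactor
      (normalizingFactor_ne_zero _ _) (extChartHomeo_trans_source_subset_baseSet hκS)⟩

end HermitianLineMetric

end AdaptedCoordinates

theorem mainTheorem3_general {E : Type*} [NormedAddCommGroup E] [NormedSpace ℂ E]
    [FiniteDimensional ℂ E] {m : ℕ} (hm : Module.finrank ℂ E = m)
    {H : Type*} [TopologicalSpace H] {I : ModelWithCorners ℂ E H} [I.Boundaryless]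
    {M : Type*} [TopologicalSpace M] [ChartedSpace H M] [IsManifold I ω M]
    {L : M → Type*} [∀ x, AddCommGroup (L x)] [∀ x, Module ℂ (L x)] [∀ x, TopologicalSpace (L x)]
    [TopologicalSpace (TotalSpace ℂ L)] [FiberBundle ℂ L] [VectorBundle ℂ ℂ L]
    [ContMDiffVectorBundle ω ℂ L I] (h : HermitianLineMetric I L)
    (hpos : ∀ p, IsHermitianInner (V := TangentSpace I p) (h.curvatureForm p)) :
    IsKahlerOn (dualModel I) (h.discMetric h.curvatureForm) h.discBundle ∧
    ∀ η₀ ∈ h.discBundle,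
      ∃ (z : OpenPartialHomeomorph M (EuclideanSpace ℂ (Fin m))) (s : ∀ x, L x)
        (Φ : OpenPartialHomeomorph (DualTotal L) (EuclideanSpace ℂ (Fin m) × ℂ)),
        IsGeodesicAt I h.curvatureForm z η₀.1 ∧
        ContMDiffOn I (I.prod 𝓘(ℂ, ℂ)) ω (fun x => TotalSpace.mk' ℂ x (s x)) z.source ∧
        h.normSq (s η₀.1) = 1 ∧
        IsHolomorphicChart (dualModel I) Φ ∧
        Φ.source = {η | η.1 ∈ z.source} ∧
        (∀ η ∈ Φ.source, Φ η = (z η.1, η.2 (s η.1))) ∧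
        (∀ (a b : EuclideanSpace ℂ (Fin m)) (α β : ℂ),
          coeffs (dualModel I) (h.discMetric h.curvatureForm) Φ.symm (Φ η₀) (a, α) (b, β) =
            (1 / (1 - ‖(Φ η₀).2‖ ^ 2) : ℝ) *
              ((1 / (1 - ‖(Φ η₀).2‖ ^ 2) : ℝ) * (α * conj β) + ∑ j, a j * conj (b j))) ∧
        ‖(Φ η₀).2‖ ^ 2 = h.dualNormSq η₀ ∧
        ∀ U : TangentSpace (dualModel I) η₀, U ≠ 0 →
          holSectCurv (dualModel I) (h.discMetric h.curvatureForm) η₀ U =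
            -2 * ((h.discMetric h.curvatureForm η₀ U U).re ^ 2 -
                (h.curvatureForm η₀.1 (dualProjDeriv η₀ U) (dualProjDeriv η₀ U)).re ^ 2 /
                    (1 - ‖(Φ η₀).2‖ ^ 2) *
                  (1 + 1 / 2 * holSectCurv I h.curvatureForm η₀.1 (dualProjDeriv η₀ U))) /
              (h.discMetric h.curvatureForm η₀ U U).re ^ 2 := by
  refine ⟨h.isKahlerOn_discMetric hpos, fun η₀ hη₀ => ?_⟩
  obtain ⟨z, s, Φ, geodesic, hs, hs1, hds, hΦ⟩ := h.exists_adapted_coordinates hm (hpos η₀.1)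
  have frame : IsHolomorphicFrameAt I s η₀.1 :=
    ⟨hs.contMDiffAt (z.open_source.mem_nhds geodesic.mem), h.ne_zero_of_normSq_eq_one hs1⟩
  have normSq_eq := h.dualNormSq_eq_of_isDualChart hΦ geodesic.mem hs1
  refine ⟨z, s, Φ, geodesic, hs, hs1, hΦ.isHolomorphicChart, hΦ.source_eq, hΦ.apply_eq,
    fun a b α β => ?_, normSq_eq.symm, fun U _ => ?_⟩
  · rw [h.coeffs_discMetric_of_isDualChart geodesic.chart hΦ hη₀ geodesic.mem frame hs1 hds,
      geodesic.unit]
  · rw [h.holSectCurv_discMetric hη₀ (hpos η₀.1), normSq_eq]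

theorem mainTheorem3 {m : ℕ}
    {M : Type*} [TopologicalSpace M] [ChartedSpace (EuclideanSpace ℂ (Fin m)) M]
    [IsManifold 𝓘(ℂ, EuclideanSpace ℂ (Fin m)) ω M]
    (L : M → Type*) [∀ x, AddCommGroup (L x)] [∀ x, Module ℂ (L x)] [∀ x, TopologicalSpace (L x)]
    [TopologicalSpace (TotalSpace ℂ L)] [FiberBundle ℂ L] [VectorBundle ℂ ℂ L]
    [ContMDiffVectorBundle ω ℂ L 𝓘(ℂ, EuclideanSpace ℂ (Fin m))]
    (h : HermitianLineMetric 𝓘(ℂ, EuclideanSpace ℂ (Fin m)) L)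
    (gM : FormField 𝓘(ℂ, EuclideanSpace ℂ (Fin m)) M)
    (hgM : IsKahlerOn 𝓘(ℂ, EuclideanSpace ℂ (Fin m)) gM Set.univ)
    (hcurv : ∀ (p : M) (U V : TangentSpace 𝓘(ℂ, EuclideanSpace ℂ (Fin m)) p),
      gM p U V = h.curvatureForm p U V) :
    IsKahlerOn (dualModel 𝓘(ℂ, EuclideanSpace ℂ (Fin m))) (h.discMetric gM) h.discBundle ∧
    ∀ η₀ ∈ h.discBundle,
      -- adapted coordinates `(z, v)`: geodesic coordinates `z` on the base, and the fibre
      -- coordinate `v` with respect to a holomorphic frame `s` of `L`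
      ∃ (z : OpenPartialHomeomorph M (EuclideanSpace ℂ (Fin m))) (s : ∀ x, L x)
        (Φ : OpenPartialHomeomorph (DualTotal L) (EuclideanSpace ℂ (Fin m) × ℂ)),
        IsGeodesicAt 𝓘(ℂ, EuclideanSpace ℂ (Fin m)) gM z η₀.1 ∧
        ContMDiffOn 𝓘(ℂ, EuclideanSpace ℂ (Fin m))
          (𝓘(ℂ, EuclideanSpace ℂ (Fin m)).prod 𝓘(ℂ, ℂ)) ω
          (fun x => TotalSpace.mk' ℂ x (s x)) z.source ∧
        h.normSq (s η₀.1) = 1 ∧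
        IsHolomorphicChart (dualModel 𝓘(ℂ, EuclideanSpace ℂ (Fin m))) Φ ∧
        Φ.source = {η | η.1 ∈ z.source} ∧
        (∀ η ∈ Φ.source, Φ η = (z η.1, η.2 (s η.1))) ∧
        -- `g_D(η₀) = (dv dv̄ / (1 - |v|²) + ∑ dz_j dz̄_j) / (1 - |v|²)`
        (∀ (a b : EuclideanSpace ℂ (Fin m)) (α β : ℂ),
          coeffs (dualModel 𝓘(ℂ, EuclideanSpace ℂ (Fin m))) (h.discMetric gM) Φ.symm (Φ η₀)
              (a, α) (b, β) =
            (1 / (1 - ‖(Φ η₀).2‖ ^ 2) : ℝ) *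
              ((1 / (1 - ‖(Φ η₀).2‖ ^ 2) : ℝ) * (α * (starRingEnd ℂ) β) +
                ∑ j, a j * (starRingEnd ℂ) (b j))) ∧
        -- the curvature formula; `|v|²` is the squared norm of `η₀`
        ‖(Φ η₀).2‖ ^ 2 = h.dualNormSq η₀ ∧
        ∀ U : TangentSpace (dualModel 𝓘(ℂ, EuclideanSpace ℂ (Fin m))) η₀, U ≠ 0 →
          holSectCurv (dualModel 𝓘(ℂ, EuclideanSpace ℂ (Fin m))) (h.discMetric gM) η₀ U =
            -2 * ((h.discMetric gM η₀ U U).re ^ 2 -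
                (gM η₀.1 (dualProjDeriv η₀ U) (dualProjDeriv η₀ U)).re ^ 2 /
                    (1 - ‖(Φ η₀).2‖ ^ 2) *
                  (1 + 1 / 2 * holSectCurv 𝓘(ℂ, EuclideanSpace ℂ (Fin m)) gM η₀.1
                    (dualProjDeriv η₀ U))) /
              (h.discMetric gM η₀ U U).re ^ 2 := by
  obtain rfl : gM = h.curvatureForm := funext fun p => funext₂ (hcurv p)
  exact mainTheorem3_general finrank_euclideanSpace_fin h fun p => hgM.hermitian p trivial
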